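/- **Setting.** Let $\zeta=(0,0,1)^T$, let $[v]_\times$ be the matrix of the cross product with $v\in\mathbb R^3$, and let $I$ be the identity matrix. Let $p_r:\mathbb R\to\mathbb R^3$ be a smooth reference trajectory whose acceleration $\ddot p_r$ is bounded on $[0,\infty)$, let $g\in\mathbb R$ be the gravity constant, and put $d(t)=\ddot p_r(t)+g\zeta$. All systems below are considered for times $t\ge 0$ and are time-varying through $d$; stability and asymptotic stability (local and global) are understood uniformly in the initial time $t_0\ge 0$. *Lyapunov functions.* A Lyapunov function on a set $D$ with respect to a set $A\subseteq D$ is a time-invariant, continuously differentiable function that vanishes on $A$, is positive on $D\setminus A$, has compact sublevel sets in $D$ (for $D$ the whole space: is radially unbounded), and whose derivative along the system is $\le 0$ at all $t\ge0$ and all points of $D$. It is *strict* if this derivative is $\le -W$ for some continuous $W:D\to\mathbb R$ with $W>0$ on $D\setminus A$, independent of $t$. **Assumption 1.** There are $\varepsilon>0$ and a continuously differentiable control law $u_\xi(\xi_1,\xi_2,d)\in\mathbb R^3$ with $\|u_\xi(\xi_1,\xi_2,d(t))\|\ge\varepsilon$ for all $t\ge0$ and $\xi_1,\xi_2\in\mathbb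 R^3$, such that the origin of $$\dot\xi_1=\xi_2,\qquad \dot\xi_2=u_\xi(\xi_1,\xi_2,d)-d \tag{4}$$ is globally asymptotically stable, and (4) has a Lyapunov function $V_\xi(\xi_1,\xi_2)$ on $\mathbb R^6$ with respect to the origin. **Closed loop.** Let $k_1,k_2,c>0$. On states $(x,R)$ with $x=(x_1,x_2,x_3)$, $x_1,x_2\in\mathbb R^3$, $x_3\in\mathcal S^2$, $R\in\mathcal{SO}(3)$, consider the error system $$\dot x_1=x_2,\quad \dot x_2=\tfrac{v}{\|v\|}f-d+R^T(\zeta-x_3)f,\quad \dot x_3=[x_3]_\times(\omega-R\omega_v),\quad \dot R=-[\omega]_\times R,$$ where $v=u_\xi(x_1,x_2,d)$, $\omega_v=[v]_\times\dot v/\|v\|^2$, and $\dot v$ is the time derivative of $v$ along the system, in closed loop with $$f=\|u_\xi(x_1,x_2,d)\|,\qquad (I-\zeta\zeta^T)\omega=(I-\zeta\zeta^T)\bigl(R\omega_v+[\zeta]_\times(\kappa_1x_3+\beta)\bigr),$$ $$\beta=k_2(1+\zeta^Tx_3)(\zeta^T\lambda)x_3-\frac{k_2(1+\zeta^Tx_3)^2c}{1-\zeta^Tx_3+c}\lambda-\frac{k_2(1+\zeta^Tx_3)\,(x_3^T(I-\zeta\zeta^T)\lambda)}{1-\zeta^Tx_3+c}x_3,$$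 $$\lambda=\|u_\xi(x_1,x_2,d)\|\,R\left(\frac{\partial V_\xi(x_1,x_2)}{\partial x_2}\right)^T .$$ Let $\mathcal A=\{(x,R): x=(0,0,\zeta),\ R\in\mathcal{SO}(3)\}$ and $\mathcal D=\{(x,R): x_3\in\mathcal S^2\setminus\{-\zeta\},\ R\in\mathcal{SO}(3)\}$. The tuning function $\kappa_1\ge k_1$ and the unspecified component $\zeta^T\omega$ are arbitrary functions of $(t,x,R)$ that are continuous on $[0,\infty)\times\mathcal D$. **Theorem 1.** Under Assumption 1: 1. $\mathcal A$ is asymptotically stable for the closed loop. 2. Its region of attraction contains $\mathcal D$: for every $t_0\ge 0$ and every initial state in $\mathcal D$ a solution on $[t_0,\infty)$ exists, every solution on a bounded interval $[t_0,T)$ can be continued to $[t_0,\infty)$, and every solution on $[t_0,\infty)$ converges to $\mathcal A$. 3. The function $$V=V_\xi(x_1,x_2)+\frac{1-\zeta^Tx_3}{2k_2(1+\zeta^Tx_3)}$$ is a Lyapunov function for the closed loop on $\mathcal D$ with respect to $\mathcal A$; if $V_\xi$ is strict for (4), then $V$ is strict for the closed loop. Moreover, the relation $x_3=Rv/\|v\|$,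 by which $x_3$ is the desired thrust direction in body-fixed coordinates, is preserved along solutions: if it holds at $t_0$, it holds at all later times. -/

import Mathlib

open Set Filter Topology
open scoped ContDiff

-- The space of `3 × 3` matrices is normed (the choice of the norm is irrelevant here).
attribute [local instance] Matrix.frobeniusNormedAddCommGroup Matrix.frobeniusNormedSpace

noncomputable section

namespace Quadrotor

/-! ### Time-varying systems `ṡ = F(t, s)`, `t ≥ 0`, on a state space `M` inside a normed space -/

section Stability

variable {X : Type*} [NormedAddCommGroup X] [NormedSpace ℝ X]

/-- `s` is a solution of `ṡ = F(t, s)` with values in `M` on the time interval `J`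
(one-sided derivatives at the endpoints that belong to `J`). -/
def IsSolution (F : ℝ → X → X) (M : Set X) (J : Set ℝ) (s : ℝ → X) : Prop :=
  ∀ t ∈ J, s t ∈ M ∧ HasDerivWithinAt s (F t (s t)) J t

/-- Stability of the set `A`, uniformly in the initial time. -/
def IsUniformlyStable (F : ℝ → X → X) (M A : Set X) : Prop :=
  ∀ ε > 0, ∃ δ > 0, ∀ t₀ T : ℝ, 0 ≤ t₀ → t₀ ≤ T → ∀ s : ℝ → X,
    IsSolution F M (Icc t₀ T) s → Metric.infDist (s t₀) A < δ → Metric.infDist (s T) A < ε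

/-- Solutions that start at distance less than `r` from `A` converge to `A`, uniformly in the
initial time and the initial state. -/
def IsUniformlyAttractiveFrom (F : ℝ → X → X) (M A : Set X) (r : ℝ) : Prop :=
  ∀ η > 0, ∃ τ > 0, ∀ t₀ T : ℝ, 0 ≤ t₀ → t₀ + τ ≤ T → ∀ s : ℝ → X,
    IsSolution F M (Icc t₀ T) s → Metric.infDist (s t₀) A < r → Metric.infDist (s T) A < η

/-- Uniform boundedness of the solutions. -/
def IsUniformlyBounded (F : ℝ → X → X) (M A : Set X) : Prop :=
  ∀ r > 0, ∃ B > 0, ∀ t₀ T : ℝ, 0 ≤ t₀ → t₀ ≤ T → ∀ s : ℝ → X,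
    IsSolution F M (Icc t₀ T) s → Metric.infDist (s t₀) A < r → Metric.infDist (s T) A < B

/-- (Uniform) asymptotic stability of the set `A`. -/
def IsAsymptoticallyStable (F : ℝ → X → X) (M A : Set X) : Prop :=
  IsUniformlyStable F M A ∧ ∃ r > 0, IsUniformlyAttractiveFrom F M A r

/-- (Uniform) global asymptotic stability of the set `A`. -/
def IsGloballyAsymptoticallyStable (F : ℝ → X → X) (M A : Set X) : Prop :=
  IsUniformlyStable F M A ∧ IsUniformlyBounded F M A ∧
    ∀ r > 0, IsUniformlyAttractiveFrom F M A r

/-- The region of attraction of `A`: the states from which, whatever the initial time `t₀ ≥ 0`, a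
solution exists on `[t₀, ∞)`, every solution on a bounded interval `[t₀, T)` continues to
`[t₀, ∞)`, and every solution on `[t₀, ∞)` converges to `A`. -/
def regionOfAttraction (F : ℝ → X → X) (M A : Set X) : Set X :=
  {s₀ | s₀ ∈ M ∧ ∀ t₀ : ℝ, 0 ≤ t₀ →
    (∃ s : ℝ → X, IsSolution F M (Ici t₀) s ∧ s t₀ = s₀) ∧
    (∀ T > t₀, ∀ s : ℝ → X, IsSolution F M (Ico t₀ T) s → s t₀ = s₀ →
      ∃ s' : ℝ → X, IsSolution F M (Ici t₀) s' ∧ EqOn s s' (Ico t₀ T)) ∧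
    (∀ s : ℝ → X, IsSolution F M (Ici t₀) s → s t₀ = s₀ →
      Tendsto (fun t => Metric.infDist (s t) A) atTop (𝓝 0))}

/-- `V` is a (continuously differentiable, time-invariant) Lyapunov function on `D` with respect
to `A ⊆ D`: it is positive definite with respect to `A`, its sublevel sets in `D` are compact
(for `D` the whole space this is radial unboundedness), and its derivative along the system is
nonpositive. -/
structure IsLyapunovFunction (F : ℝ → X → X) (A D : Set X) (V : X → ℝ) : Prop where
  contDiffAt : ∀ s ∈ D, ContDiffAt ℝ 1 V s
  eq_zero : ∀ s ∈ A, V s = 0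
  pos : ∀ s ∈ D \ A, 0 < V s
  isCompact_sublevel : ∀ c : ℝ, IsCompact {s | s ∈ D ∧ V s ≤ c}
  deriv_nonpos : ∀ t : ℝ, 0 ≤ t → ∀ s ∈ D, fderiv ℝ V s (F t s) ≤ 0

/-- A Lyapunov function is strict if its derivative along the system is negative definite with
respect to `A`, uniformly in time. -/
def IsStrictLyapunovFunction (F : ℝ → X → X) (A D : Set X) (V : X → ℝ) : Prop :=
  IsLyapunovFunction F A D V ∧
    ∃ W : X → ℝ, ContinuousOn W D ∧ (∀ s ∈ D \ A, 0 < W s) ∧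
      ∀ t : ℝ, 0 ≤ t → ∀ s ∈ D, fderiv ℝ V s (F t s) ≤ -W s

end Stability

/-! ### The quadrotor -/

/-- Euclidean three-space. -/
abbrev E3 := EuclideanSpace ℝ (Fin 3)

/-- Real `3 × 3` matrices. -/
abbrev Mat3 := Matrix (Fin 3) (Fin 3) ℝ

/-- The rotation group. -/
def SO3 : Set Mat3 := {R | R ∈ Matrix.specialOrthogonalGroup (Fin 3) ℝ}

/-- The product of a matrix and a vector of Euclidean space. -/
def act (A : Mat3) (x : E3) : E3 := Matrix.toEuclideanLin A x

/-- The unit vector of the `Z` axis. -/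
def zeta : E3 := !₂[0, 0, 1]

/-- The matrix `[v]ₓ` of the cross product with `v`. -/
def skew (v : E3) : Mat3 :=
  !![0, -v 2, v 1;
     v 2, 0, -v 0;
     -v 1, v 0, 0]

/-- The projection `I - ζ ζᵀ`. -/
def proj : Mat3 := 1 - Matrix.vecMulVec (fun i => zeta i) (fun i => zeta i)

/-- The signal `d = p̈_r + g ζ`. -/
def dSignal (pr : ℝ → E3) (g : ℝ) (t : ℝ) : E3 := iteratedDeriv 2 pr t + g • zeta

/-- The controlled double integrator `ξ̇₁ = ξ₂`, `ξ̇₂ = u_ξ(ξ₁, ξ₂, d(t)) - d(t)`. -/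
def doubleIntegrator (u : E3 × E3 × E3 → E3) (d : ℝ → E3) (t : ℝ) (ξ : E3 × E3) : E3 × E3 :=
  (ξ.2, u (ξ.1, ξ.2, d t) - d t)

/-- States `(x₁, x₂, x₃, R)`. -/
abbrev State := E3 × E3 × E3 × Mat3

/-- The state space `ℝ³ × ℝ³ × S² × SO(3)`. -/
def stateSpace : Set State := {s | ‖s.2.2.1‖ = 1 ∧ s.2.2.2 ∈ SO3}

/-- The set `𝒜` of the states with `x = (0, 0, ζ)` and `R ∈ SO(3)`. -/
def setA : Set State := {s | s.1 = 0 ∧ s.2.1 = 0 ∧ s.2.2.1 = zeta ∧ s.2.2.2 ∈ SO3}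

/-- The set `𝒟` of the states with `x₃ ∈ S² \ {-ζ}` and `R ∈ SO(3)`. -/
def setD : Set State := {s | ‖s.2.2.1‖ = 1 ∧ s.2.2.1 ≠ -zeta ∧ s.2.2.2 ∈ SO3}

/-- `ω_v = [v]ₓ v̇ / ‖v‖²`. -/
def omegaV (v dv : E3) : E3 := (‖v‖ ^ 2)⁻¹ • act (skew v) dv

/-- The right-hand side of the `x₂`-equation, `(f / ‖v‖) v - d + f Rᵀ (ζ - x₃)`. -/
def x2Dot (v d : E3) (f : ℝ) (x₃ : E3) (R : Mat3) : E3 :=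
  (f / ‖v‖) • v - d + f • act R.transpose (zeta - x₃)

/-- The error dynamics, with virtual control `v` (of time derivative `dv`), thrust `f` and angular
velocity `w`: `ẋ₁ = x₂`, `ẋ₂ = (f / ‖v‖) v - d + f Rᵀ (ζ - x₃)`, `ẋ₃ = [x₃]ₓ (w - R ω_v)`,
`Ṙ = -[w]ₓ R`. -/
def errorDynamics (v dv d : E3) (f : ℝ) (w : E3) (s : State) : State :=
  (s.2.1,
   x2Dot v d f s.2.2.1 s.2.2.2,
   act (skew s.2.2.1) (w - act s.2.2.2 (omegaV v dv)),
   -(skew w * s.2.2.2))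

/-- `λ = ‖v‖ R (∂V_ξ/∂x₂)ᵀ`. -/
def lambdaTerm (Vξ : E3 × E3 → ℝ) (v : E3) (s : State) : E3 :=
  ‖v‖ • act s.2.2.2 (gradient (fun y => Vξ (s.1, y)) s.2.1)

/-- The term `β` of the angular velocity law. -/
def betaTerm (k₂ c : ℝ) (x₃ lam : E3) : E3 :=
  (k₂ * (1 + inner ℝ zeta x₃) * inner ℝ zeta lam) • x₃
    - (k₂ * (1 + inner ℝ zeta x₃) ^ 2 * c / (1 - inner ℝ zeta x₃ + c)) • lam
    - (k₂ * (1 + inner ℝ zeta x₃) * inner ℝ x₃ (act proj lam)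
        / (1 - inner ℝ zeta x₃ + c)) • x₃

/-- The virtual control `v = u_ξ(x₁, x₂, d)`. -/
def virtualControl (u : E3 × E3 × E3 → E3) (d : ℝ → E3) (t : ℝ) (s : State) : E3 :=
  u (s.1, s.2.1, d t)

/-- The thrust law `f = ‖u_ξ(x₁, x₂, d)‖`. -/
def thrust (u : E3 × E3 × E3 → E3) (d : ℝ → E3) (t : ℝ) (s : State) : ℝ :=
  ‖virtualControl u d t s‖

/-- The time derivative `v̇` of the virtual control along the closed loop (chain rule). -/
def virtualControlDot (u : E3 × E3 × E3 → E3) (d : ℝ → E3) (t : ℝ) (s : State) : E3 :=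
  fderiv ℝ u (s.1, s.2.1, d t)
    (s.2.1,
     x2Dot (virtualControl u d t s) (d t) (thrust u d t s) s.2.2.1 s.2.2.2,
     deriv d t)

/-- The angular velocity law: `(I - ζζᵀ) ω = (I - ζζᵀ) (R ω_v + [ζ]ₓ (κ₁ x₃ + β))`, while the
component `ζᵀ ω = ψ` about the thrust axis is left free. -/
def angularVelocity (u : E3 × E3 × E3 → E3) (Vξ : E3 × E3 → ℝ) (d : ℝ → E3) (k₂ c : ℝ)
    (κ₁ ψ : ℝ → State → ℝ) (t : ℝ) (s : State) : E3 :=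
  ψ t s • zeta
    + act proj
        (act s.2.2.2 (omegaV (virtualControl u d t s) (virtualControlDot u d t s))
          + act (skew zeta)
              (κ₁ t s • s.2.2.1
                + betaTerm k₂ c s.2.2.1 (lambdaTerm Vξ (virtualControl u d t s) s)))

/-- The closed-loop error system. -/
def closedLoop (u : E3 × E3 × E3 → E3) (Vξ : E3 × E3 → ℝ) (d : ℝ → E3) (k₂ c : ℝ)
    (κ₁ ψ : ℝ → State → ℝ) (t : ℝ) (s : State) : State :=
  errorDynamics (virtualControl u d t s) (virtualControlDot u d t s) (d t) (thrust u d t s)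
    (angularVelocity u Vξ d k₂ c κ₁ ψ t s) s

/-- The composite function `V_ξ(x₁, x₂) + (1 - ζᵀx₃) / (2 k₂ (1 + ζᵀx₃))`. -/
def compositeV (Vξ : E3 × E3 → ℝ) (k₂ : ℝ) (s : State) : ℝ :=
  Vξ (s.1, s.2.1) + (1 - inner ℝ zeta s.2.2.1) / (2 * k₂ * (1 + inner ℝ zeta s.2.2.1))

/-- The states at time `t` at which `x₃` is the desired thrust direction in body-fixed coordinates,
`x₃ = R v / ‖v‖`. -/
def thrustConstraint (u : E3 × E3 × E3 → E3) (d : ℝ → E3) (t : ℝ) : Set State :=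
  {s | s.2.2.1 = act s.2.2.2 (‖virtualControl u d t s‖⁻¹ • virtualControl u d t s)}

end Quadrotor

end

open Quadrotor

/-!
The composite function `V = V_ξ + (1 - z) / (2 k₂ (1 + z))`, `z = ζᵀx₃`, is built so that the term
`β` of the angular velocity law cancels the coupling between translation and attitude: along the
closed loop `V̇ = V̇_ξ - (κ₁ / k₂) φ` with `φ = (1 - z) / (1 + z)`, where `V̇_ξ ≤ 0` is the derivative
of `V_ξ` along the double integrator (`fderiv_compositeV_closedLoop`). This gives the Lyapunov
function, its strictness, uniform stability, and the invariance of the compact sublevel sets of `V`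
in `𝒟`.

Since `V` need not be strict, convergence is obtained by comparison with the unperturbed double
integrator (`exists_time_compositeV_lt`). As `V` is nonnegative and nonincreasing, on one of
sufficiently many consecutive windows of fixed length it decreases by an arbitrarily small amount.
On such a window the integral of `φ` is small. The squared coupling term is at most a multiple of
`φ`, hence of `-V̇`, so the squared distance to the solution of the double integrator with the same
initial state, plus a multiple of `V`, satisfies a Grönwall inequality
(`norm_sub_sq_le_of_isSolution`). By the asymptotic stability of the double integrator the
translational state comes close to the origin, and by the mean value theorem `φ` is small at some
time near the end of the window; there `V` is small, and it stays small. All bounds are uniform in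
the initial time because `d` is bounded.

The right-hand side is merely continuous, so existence of solutions rests on Peano's theorem
(`exists_solution_of_continuous_of_bounded`). It is applied to a bounded continuous extension of the
closed loop that keeps the kinematic form `ẋ₃ = [x₃]ₓ e`, `Ṙ = -[w]ₓ R` and therefore leaves the
sphere and the rotation group invariant; compactness of the sublevel sets prevents escape.

Finally, `x₃` and `R v / ‖v‖` solve the same linear equation `ẏ = [y]ₓ (ω - R ω_v)`, so that the norm
of their difference is constant (`thrustConstraint_of_isSolution`).
-/

namespace Quadrotor

/-! ### Peano's existence theorem -/

section Peano

variable {X : Type*} [NormedAddCommGroup X] [NormedSpace ℝ X]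

/-- Tonelli's iteration for the delayed equation `ẏ(t) = G(t, y(t - h))`, `t ≥ a`, with the constant
history `y = x₀` on `(-∞, a]`. The iterate of index `k` solves the equation on `[a, a + k h]`. -/
noncomputable def tonelliIterate (G : ℝ → X → X) (a h : ℝ) (x₀ : X) : ℕ → ℝ → X
  | 0, _ => x₀
  | k + 1, t => x₀ + ∫ r in a..max a t, G r (tonelliIterate G a h x₀ k (r - h))

variable {G : ℝ → X → X} {a h C : ℝ} {x₀ : X}

theorem continuous_tonelliIterate (hG : Continuous fun q : ℝ × X => G q.1 q.2) (k : ℕ) :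
    Continuous (tonelliIterate G a h x₀ k) := by
  induction k with
  | zero => exact continuous_const
  | succ k ih =>
    have hint : Continuous fun r => G r (tonelliIterate G a h x₀ k (r - h)) :=
      hG.comp (continuous_id.prodMk (ih.comp (continuous_id.sub continuous_const)))
    exact continuous_const.add
      ((intervalIntegral.continuous_primitive (fun p q => hint.intervalIntegrable p q) a).comp
        (continuous_const.max continuous_id))

theorem tonelliIterate_succ_sub (hG : Continuous fun q : ℝ × X => G q.1 q.2) (k : ℕ) (s t : ℝ) :
    tonelliIterate G a h x₀ (k + 1) t - tonelliIterate G a h x₀ (k + 1) s =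
      ∫ r in max a s..max a t, G r (tonelliIterate G a h x₀ k (r - h)) := by
  have hint : Continuous fun r => G r (tonelliIterate G a h x₀ k (r - h)) :=
    hG.comp (continuous_id.prodMk
      ((continuous_tonelliIterate hG k).comp (continuous_id.sub continuous_const)))
  simp only [tonelliIterate, add_sub_add_left_eq_sub]
  exact intervalIntegral.integral_interval_sub_left (hint.intervalIntegrable _ _)
    (hint.intervalIntegrable _ _)

theorem tonelliIterate_stable (hh : 0 ≤ h) (k : ℕ) {t : ℝ} (ht : t ≤ a + k * h) :
    tonelliIterate G a h x₀ (k + 1) t = tonelliIterate G a h x₀ k t := by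
  induction k generalizing t with
  | zero =>
    have : max a t = a := max_eq_left (by simpa using ht)
    simp [tonelliIterate, this]
  | succ k ih =>
    rw [tonelliIterate, tonelliIterate]
    congr 1
    refine intervalIntegral.integral_congr fun r hr => ?_
    rw [uIcc_of_le (le_max_left _ _)] at hr
    have hr2 : r ≤ a + (k + 1) * h := by
      refine hr.2.trans (max_le ?_ (by exact_mod_cast ht))
      have : (0 : ℝ) ≤ (k + 1) * h := by positivity
      linarith
    rw [ih (by linarith)]

/-- The delayed equation `ẏ(t) = G(t, y(t - h))` has a solution on `[a, b]`, with a Lipschitz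
constant that does not depend on the delay. -/
theorem exists_delayed_solution (hG : Continuous fun q : ℝ × X => G q.1 q.2)
    (hC : ∀ t x, ‖G t x‖ ≤ C) (a b : ℝ) (hh : 0 < h) (x₀ : X) :
    ∃ y : ℝ → X, Continuous y ∧ y a = x₀ ∧ (∀ s t, ‖y t - y s‖ ≤ C * |t - s|) ∧
      ∀ s ∈ Icc a b, ∀ t ∈ Icc a b, y t - y s = ∫ r in s..t, G r (y (r - h)) := by
  obtain ⟨N, hN⟩ := exists_nat_ge ((b - a) / h)
  rw [div_le_iff₀ hh] at hN
  refine ⟨tonelliIterate G a h x₀ (N + 1), continuous_tonelliIterate hG _,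
    by simp [tonelliIterate], fun s t => ?_, fun s hs t ht => ?_⟩
  · rw [tonelliIterate_succ_sub hG]
    refine (intervalIntegral.norm_integral_le_of_norm_le_const fun r _ => hC _ _).trans ?_
    have : 0 ≤ C := (norm_nonneg _).trans (hC 0 0)
    gcongr 1
    exact (abs_max_sub_max_le_max a t a s).trans (by simp)
  · rw [tonelliIterate_succ_sub hG, max_eq_right hs.1, max_eq_right ht.1]
    refine intervalIntegral.integral_congr fun r hr => ?_
    have hr2 : r ≤ b := (uIcc_subset_Icc hs ht hr).2
    rw [tonelliIterate_stable hh.le N (by linarith)]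

/-- **Peano's theorem** for a bounded continuous right-hand side. The solution is the pointwise
limit, along an ultrafilter, of solutions of delayed equations whose delays tend to `0`. -/
theorem exists_solution_of_continuous_of_bounded [ProperSpace X]
    (hG : Continuous fun q : ℝ × X => G q.1 q.2)
    (hC : ∀ t x, ‖G t x‖ ≤ C) (a b : ℝ) (x₀ : X) :
    ∃ y : ℝ → X, y a = x₀ ∧ ∀ t ∈ Icc a b, HasDerivWithinAt y (G t (y t)) (Icc a b) t := by
  have hC0 : 0 ≤ C := (norm_nonneg _).trans (hC 0 0)
  have hpos : ∀ n : ℕ, (0 : ℝ) < 1 / (n + 1) := fun n => Nat.one_div_pos_of_nat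
  choose z hzc hza hzL hzI using
    fun n : ℕ => exists_delayed_solution hG hC a b (hpos n) x₀
  let U : Ultrafilter ℕ := hyperfilter ℕ
  have hlim : ∀ t, ∃ x, Tendsto (fun n => z n t) U (𝓝 x) := by
    intro t
    have hmem : ∀ n, z n t ∈ Metric.closedBall x₀ (C * |t - a|) := fun n => by
      rw [mem_closedBall_iff_norm, ← hza n]
      exact hzL n a t
    obtain ⟨x, -, hx⟩ := (isCompact_closedBall x₀ (C * |t - a|)).ultrafilter_le_nhds'
      (U.map fun n => z n t) (Ultrafilter.mem_map.2 (Filter.Eventually.of_forall hmem))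
    exact ⟨x, hx⟩
  choose y hy using hlim
  refine ⟨y, tendsto_nhds_unique (hy a) (by simp [hza]), fun t ht => ?_⟩
  rw [hasDerivWithinAt_iff_isLittleO, Asymptotics.isLittleO_iff]
  intro ε hε
  obtain ⟨δ, hδ, hGδ⟩ := Metric.continuous_iff.1 hG (t, y t) ε hε
  have hδ' : 0 < min δ (δ / (3 * (C + 1))) := by positivity
  filter_upwards [self_mem_nhdsWithin, mem_nhdsWithin_of_mem_nhds (Metric.ball_mem_nhds t hδ')]
    with t' ht' htt'
  rw [Metric.mem_ball, Real.dist_eq, lt_min_iff, lt_div_iff₀ (by positivity)] at htt'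
  have h1 : ∀ᶠ n in (U : Filter ℕ), ‖z n t - y t‖ < δ / 3 := by
    filter_upwards [(hy t) (Metric.ball_mem_nhds (y t) (by positivity : 0 < δ / 3))] with n hn
    simpa [dist_eq_norm] using hn
  have h2 : ∀ᶠ n : ℕ in (U : Filter ℕ), C * (1 / ((n : ℝ) + 1)) < δ / 3 := by
    refine Nat.hyperfilter_le_atTop ?_
    have := (tendsto_one_div_add_atTop_nhds_zero_nat (𝕜 := ℝ)).const_mul C
    rw [mul_zero] at this
    exact this.eventually (gt_mem_nhds (by positivity))
  have hbound : ∀ᶠ n in (U : Filter ℕ),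
      ‖z n t' - z n t - (t' - t) • G t (y t)‖ ≤ ε * ‖t' - t‖ := by
    filter_upwards [h1, h2] with n hn1 hn2
    have hcont : Continuous fun r => G r (z n (r - 1 / ((n : ℝ) + 1))) :=
      hG.comp (continuous_id.prodMk ((hzc n).comp (continuous_id.sub continuous_const)))
    rw [hzI n t ht t' ht', ← intervalIntegral.integral_const,
      ← intervalIntegral.integral_sub (hcont.intervalIntegrable _ _)
        (continuous_const.intervalIntegrable _ _)]
    refine intervalIntegral.norm_integral_le_of_norm_le_const fun r hr => ?_
    have hrt : |r - t| ≤ |t' - t| := by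
      have := abs_sub_left_of_mem_uIcc (uIoc_subset_uIcc hr)
      exact this
    rw [← dist_eq_norm]
    refine (hGδ (r, z n (r - 1 / ((n : ℝ) + 1))) ?_).le
    rw [Prod.dist_eq, max_lt_iff, Real.dist_eq, dist_eq_norm]
    refine ⟨hrt.trans_lt htt'.1, ?_⟩
    have h3 : ‖z n (r - 1 / ((n : ℝ) + 1)) - z n t‖ ≤ C * (|t' - t| + 1 / (n + 1)) := by
      refine (hzL n _ _).trans ?_
      gcongr
      calc |r - 1 / ((n : ℝ) + 1) - t| = |(r - t) - 1 / ((n : ℝ) + 1)| := by ring_nf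
        _ ≤ |r - t| + |1 / ((n : ℝ) + 1)| := abs_sub _ _
        _ ≤ |t' - t| + 1 / (n + 1) := by rw [abs_of_pos (hpos n)]; linarith
    calc ‖z n (r - 1 / ((n : ℝ) + 1)) - y t‖
        ≤ ‖z n (r - 1 / ((n : ℝ) + 1)) - z n t‖ + ‖z n t - y t‖ :=
          norm_sub_le_norm_sub_add_norm_sub _ _ _
      _ < δ := by nlinarith [abs_nonneg (t' - t)]
  exact le_of_tendsto ((((hy t').sub (hy t)).sub tendsto_const_nhds).norm) hbound

end Peano

/-! ### Solutions, Lyapunov functions and continuation -/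

section Lyapunov

variable {X : Type*} [NormedAddCommGroup X] [NormedSpace ℝ X]
variable {F : ℝ → X → X} {M A D O : Set X} {V : X → ℝ}

theorem IsSolution.mono {J J' : Set ℝ} {s : ℝ → X} (h : IsSolution F M J s) (hJ : J' ⊆ J) :
    IsSolution F M J' s := fun t ht => ⟨(h t (hJ ht)).1, (h t (hJ ht)).2.mono hJ⟩

theorem IsSolution.congr {J : Set ℝ} {s s' : ℝ → X} (h : IsSolution F M J s)
    (he : EqOn s' s J) : IsSolution F M J s' := fun t ht => by
  rw [he ht]
  exact ⟨(h t ht).1, (h t ht).2.congr he (he ht)⟩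

theorem IsSolution.continuousOn {J : Set ℝ} {s : ℝ → X} (h : IsSolution F M J s) :
    ContinuousOn s J := fun t ht => (h t ht).2.continuousWithinAt

theorem IsSolution.union {J J' : Set ℝ} {s : ℝ → X} (h : IsSolution F M J s)
    (h' : IsSolution F M J' s) (hJ : IsClosed J) (hJ' : IsClosed J') :
    IsSolution F M (J ∪ J') s := by
  have aux : ∀ {I : Set ℝ}, IsSolution F M I s → IsClosed I → ∀ t,
      HasDerivWithinAt s (F t (s t)) I t := fun {I} hI hc t => by
    by_cases ht : t ∈ I
    · exact (hI t ht).2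
    · exact HasFDerivWithinAt.of_notMem_closure (by rwa [hc.closure_eq])
  exact fun t ht => ⟨ht.elim (fun k => (h t k).1) fun k => (h' t k).1,
    (aux h hJ t).union (aux h' hJ' t)⟩

/-- Concatenation of a solution up to the time `b` with a solution from the time `b` on. -/
theorem IsSolution.concat {J J' : Set ℝ} {b : ℝ} {s s' : ℝ → X} (h : IsSolution F M J s)
    (h' : IsSolution F M J' s') (hJ : IsClosed J) (hJ' : IsClosed J') (hb : J ⊆ Iic b)
    (hb' : J' ⊆ Ici b) (heq : s b = s' b) :
    IsSolution F M (J ∪ J') (fun t => if t ≤ b then s t else s' t) := by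
  refine IsSolution.union (h.congr fun t ht => if_pos (hb ht)) (h'.congr fun t ht => ?_) hJ hJ'
  rcases eq_or_lt_of_le (show b ≤ t from hb' ht) with rfl | hlt
  · simp [heq]
  · exact if_neg hlt.not_ge

theorem IsLyapunovFunction.hasDerivWithinAt (hV : IsLyapunovFunction F A D V) {s : ℝ → X}
    {v : X} {J : Set ℝ} {t : ℝ} (hs : HasDerivWithinAt s v J t) (hD : s t ∈ D) :
    HasDerivWithinAt (fun r => V (s r)) (fderiv ℝ V (s t) v) J t :=
  ((hV.contDiffAt _ hD).differentiableAt one_ne_zero).hasFDerivAt.comp_hasDerivWithinAt t hs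

theorem IsLyapunovFunction.antitoneOn (hV : IsLyapunovFunction F A D V) {s : ℝ → X} {a b : ℝ}
    (ha : 0 ≤ a) (hD : ∀ t ∈ Icc a b, s t ∈ D)
    (hs : ∀ t ∈ Icc a b, HasDerivWithinAt s (F t (s t)) (Icc a b) t) :
    AntitoneOn (fun t => V (s t)) (Icc a b) := by
  refine antitoneOn_of_hasDerivWithinAt_nonpos (f' := fun t => fderiv ℝ V (s t) (F t (s t)))
    (convex_Icc a b)
    (fun t ht => (hV.hasDerivWithinAt (hs t ht) (hD t ht)).continuousWithinAt)
    (fun t ht => ((hV.hasDerivWithinAt (hs t (interior_subset ht))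
      (hD t (interior_subset ht))).mono interior_subset)) fun t ht => ?_
  have ht' := interior_subset ht
  exact hV.deriv_nonpos t (ha.trans ht'.1) _ (hD t ht')

/-- A trajectory in `M` that starts in the relatively open subset `D = M ∩ O` and solves the system
as long as it is in `D` and `V < c'` never leaves `D`: it would have to leave a compact sublevel set
of the nonincreasing function `V`. -/
theorem IsLyapunovFunction.mem_of_hasDerivWithinAt (hV : IsLyapunovFunction F A D V)
    (hO : IsOpen O) (hDO : D = M ∩ O) {s : ℝ → X} {a b c' : ℝ} (ha : 0 ≤ a)
    (hM : ∀ t ∈ Icc a b, s t ∈ M) (hcont : ContinuousOn s (Icc a b))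
    (hs : ∀ t ∈ Icc a b, s t ∈ D → V (s t) < c' → HasDerivWithinAt s (F t (s t)) (Icc a b) t)
    (h0 : s a ∈ D) (hc : V (s a) < c') :
    ∀ t ∈ Icc a b, s t ∈ D ∧ V (s t) ≤ V (s a) := by
  set K := {x | x ∈ D ∧ V x ≤ V (s a)} with hK
  have hclosed : IsClosed ((s ⁻¹' K) ∩ Icc a b) := by
    rw [inter_comm]
    exact hcont.preimage_isClosed_of_isClosed isClosed_Icc (hV.isCompact_sublevel _).isClosed
  refine hclosed.Icc_subset_of_forall_exists_gt ⟨h0, le_rfl⟩ ?_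
  rintro x ⟨⟨hxD, hxV⟩, hxI⟩ y hxy
  have hxI' : x ∈ Icc a b := ⟨hxI.1, hxI.2.le⟩
  have hxO : s x ∈ O := by rw [hDO] at hxD; exact hxD.2
  have hnear : ∀ᶠ r in 𝓝[Icc a b] x, s r ∈ D ∧ V (s r) < c' := by
    have h1 : ∀ᶠ r in 𝓝[Icc a b] x, s r ∈ O := (hcont x hxI') (hO.mem_nhds hxO)
    have h2 : ∀ᶠ r in 𝓝[Icc a b] x, V (s r) < c' :=
      ((hV.contDiffAt _ hxD).continuousAt.comp_continuousWithinAt (hcont x hxI'))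
        (gt_mem_nhds (hxV.trans_lt hc))
    filter_upwards [h1, h2, self_mem_nhdsWithin] with r hr1 hr2 hr3
    exact ⟨by rw [hDO]; exact ⟨hM r hr3, hr1⟩, hr2⟩
  obtain ⟨δ, hδ, hball⟩ := Metric.mem_nhdsWithin_iff.1 hnear
  set z := min (min y b) (x + δ / 2)
  have hxz : x < z := lt_min (lt_min hxy hxI.2) (by linarith)
  have hzb : z ≤ b := (min_le_left _ _).trans (min_le_right _ _)
  have hsub : Icc x z ⊆ Icc a b := Icc_subset_Icc hxI.1 hzb
  have hin : ∀ r ∈ Icc x z, s r ∈ D ∧ V (s r) < c' := fun r hr => by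
    refine hball ⟨?_, hsub hr⟩
    rw [Metric.mem_ball, Real.dist_eq, abs_of_nonneg (by linarith [hr.1])]
    have : r ≤ x + δ / 2 := hr.2.trans (min_le_right _ _)
    linarith
  have hanti := hV.antitoneOn (ha.trans hxI.1) (fun r hr => (hin r hr).1)
    fun r hr => (hs r (hsub hr) (hin r hr).1 (hin r hr).2).mono hsub
  refine ⟨z, ⟨(hin z ⟨hxz.le, le_rfl⟩).1, ?_⟩, hxz, (min_le_left _ _).trans (min_le_left _ _)⟩
  exact (hanti ⟨le_rfl, hxz.le⟩ ⟨hxz.le, le_rfl⟩ hxz.le).trans hxV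

theorem IsSolution.mem_and_le (hV : IsLyapunovFunction F A D V)
    (hO : IsOpen O) (hDO : D = M ∩ O) {s : ℝ → X} {a b : ℝ} (ha : 0 ≤ a)
    (hs : IsSolution F M (Icc a b) s) (h0 : s a ∈ D) :
    ∀ t ∈ Icc a b, s t ∈ D ∧ V (s t) ≤ V (s a) :=
  hV.mem_of_hasDerivWithinAt hO hDO ha (fun t ht => (hs t ht).1) hs.continuousOn
    (fun t ht _ _ => (hs t ht).2) h0 (lt_add_one _)

theorem IsSolution.antitoneOn (hV : IsLyapunovFunction F A D V)
    (hO : IsOpen O) (hDO : D = M ∩ O) {s : ℝ → X} {a b : ℝ} (ha : 0 ≤ a)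
    (hs : IsSolution F M (Icc a b) s) (h0 : s a ∈ D) :
    AntitoneOn (fun t => V (s t)) (Icc a b) :=
  hV.antitoneOn ha (fun t ht => (hs.mem_and_le hV hO hDO ha h0 t ht).1) fun t ht => (hs t ht).2

/-- On `[a, b] × K` the system agrees with a bounded continuous system on the whole space that
leaves `M` invariant. -/
def HasTangentExtension (F : ℝ → X → X) (M K : Set X) (a b : ℝ) : Prop :=
  ∃ G : ℝ → X → X, Continuous (fun q : ℝ × X => G q.1 q.2) ∧ (∃ C, ∀ t x, ‖G t x‖ ≤ C) ∧
    (∀ t ∈ Icc a b, ∀ x ∈ K, G t x = F t x) ∧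
    ∀ s : ℝ → X, (∀ t ∈ Icc a b, HasDerivWithinAt s (G t (s t)) (Icc a b) t) → s a ∈ M →
      ∀ t ∈ Icc a b, s t ∈ M

theorem exists_isSolution_Icc [ProperSpace X] (hV : IsLyapunovFunction F A D V)
    (hO : IsOpen O) (hDO : D = M ∩ O) {a b : ℝ} (ha : 0 ≤ a) {x₀ : X} (hx₀ : x₀ ∈ D)
    (hext : HasTangentExtension F M {x | x ∈ D ∧ V x ≤ V x₀ + 1} a b) :
    ∃ s, IsSolution F M (Icc a b) s ∧ s a = x₀ := by
  obtain ⟨G, hGc, ⟨C, hC⟩, hGF, hGM⟩ := hext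
  obtain ⟨s, hsa, hs⟩ := exists_solution_of_continuous_of_bounded hGc hC a b x₀
  have hM : ∀ t ∈ Icc a b, s t ∈ M := hGM s hs (by rw [hsa]; rw [hDO] at hx₀; exact hx₀.1)
  have hD := hV.mem_of_hasDerivWithinAt hO hDO (c' := V x₀ + 1) ha hM
    (fun t ht => (hs t ht).continuousWithinAt)
    (fun t ht hD hlt => by rw [← hGF t ht _ ⟨hD, hlt.le⟩]; exact hs t ht)
    (by rwa [hsa]) (by rw [hsa]; linarith)
  refine ⟨s, fun t ht => ⟨hM t ht, ?_⟩, hsa⟩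
  rw [← hGF t ht _ ⟨(hD t ht).1, by have := (hD t ht).2; rw [hsa] at this; linarith⟩]
  exact hs t ht

/-- If solutions can always be prolonged by a unit of time, they exist for all times. -/
theorem exists_isSolution_Ici {t₀ : ℝ}
    (hstep : ∀ a ≥ t₀, ∀ x ∈ D, ∃ s, IsSolution F M (Icc a (a + 1)) s ∧ s a = x ∧ s (a + 1) ∈ D)
    {x₀ : X} (hx₀ : x₀ ∈ D) : ∃ s, IsSolution F M (Ici t₀) s ∧ s t₀ = x₀ := by
  choose! p hp hpa hpD using hstep
  -- the `n`-th function solves the system on `[t₀, t₀ + n]`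
  let f : ℕ → ℝ → X := fun n => Nat.rec (fun _ => x₀)
    (fun n s t => if t ≤ t₀ + n then s t else p (t₀ + n) (s (t₀ + n)) t) n
  have hf0 : f 0 = fun _ => x₀ := rfl
  have hfs : ∀ n t, f (n + 1) t =
      if t ≤ t₀ + n then f n t else p (t₀ + n) (f n (t₀ + n)) t := fun n t => rfl
  have hge : ∀ n : ℕ, t₀ ≤ t₀ + n := fun n => by simp
  have hstart : ∀ n, f n t₀ = x₀ := fun n => by
    induction n with
    | zero => rfl
    | succ n ih => rw [hfs, if_pos (hge n), ih]
  have hfD : ∀ n : ℕ, f n (t₀ + n) ∈ D := fun n => by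
    induction n with
    | zero => simpa [hf0] using hx₀
    | succ n ih =>
      rw [hfs]
      simp only [Nat.cast_add, Nat.cast_one, ← add_assoc]
      rw [if_neg (by linarith)]
      exact hpD _ (hge n) _ ih
  have hsol : ∀ n : ℕ, IsSolution F M (Icc t₀ (t₀ + (n + 1 : ℕ))) (f (n + 1)) := fun n => by
    induction n with
    | zero =>
      have h1 := hp t₀ le_rfl x₀ hx₀
      simp only [zero_add, Nat.cast_one]
      refine h1.congr fun t ht => (hfs 0 t).trans ?_
      simp only [hf0, Nat.cast_zero, add_zero]
      split_ifs with h
      · rw [le_antisymm h ht.1, hpa t₀ le_rfl x₀ hx₀]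
      · rfl
    | succ n ih =>
      have h1 := hp _ (hge (n + 1)) _ (hfD (n + 1))
      have h2 := ih.concat (b := t₀ + (n + 1 : ℕ)) h1 isClosed_Icc isClosed_Icc
        (fun t ht => ht.2) (fun t ht => ht.1) (hpa _ (hge (n + 1)) _ (hfD (n + 1))).symm
      rw [Icc_union_Icc_eq_Icc (hge _) (by linarith)] at h2
      have h3 : t₀ + ((n + 1 + 1 : ℕ) : ℝ) = t₀ + (n + 1 : ℕ) + 1 := by
        push_cast
        ring
      rw [h3]
      exact h2.congr fun t _ => hfs (n + 1) t
  have hmono : ∀ (n m : ℕ) (t : ℝ), n ≤ m → t ≤ t₀ + n → f m t = f n t := fun n m t hnm ht => by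
    induction m, hnm using Nat.le_induction with
    | base => rfl
    | succ m hm ih =>
      have : (n : ℝ) ≤ m := by exact_mod_cast hm
      rw [hfs, if_pos (by linarith), ih]
  have hlim : ∀ (n : ℕ) (t : ℝ), t ≤ t₀ + n → f (⌈t - t₀⌉₊) t = f n t := fun n t ht => by
    have h1 : t ≤ t₀ + ⌈t - t₀⌉₊ := by linarith [Nat.le_ceil (t - t₀)]
    rw [← hmono _ (max n ⌈t - t₀⌉₊) t (le_max_left _ _) ht,
      ← hmono _ (max n ⌈t - t₀⌉₊) t (le_max_right _ _) h1]
  refine ⟨fun t => f (⌈t - t₀⌉₊) t, fun t ht => ?_, hstart _⟩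
  obtain ⟨n, hn⟩ := exists_nat_gt (t - t₀)
  have hlt : t < t₀ + (n + 1 : ℕ) := by push_cast; linarith
  have hS : IsSolution F M (Icc t₀ (t₀ + (n + 1 : ℕ))) (fun t => f (⌈t - t₀⌉₊) t) :=
    (hsol n).congr fun r hr => hlim (n + 1) r hr.2
  refine ⟨(hS t ⟨ht, hlt.le⟩).1, ((hS t ⟨ht, hlt.le⟩).2).mono_of_mem_nhdsWithin ?_⟩
  rw [← Ici_inter_Iic]
  exact inter_mem_nhdsWithin _ (Iic_mem_nhds hlt)

/-- A solution on `[t₀, T)` that starts in `D` extends to a solution on `[t₀, T]`: it stays in a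
compact set, on which the right-hand side is bounded, so that it is Lipschitz. -/
theorem IsSolution.exists_extend_Icc [FiniteDimensional ℝ X] (hV : IsLyapunovFunction F A D V)
    (hO : IsOpen O) (hDO : D = M ∩ O)
    (hF : ContinuousOn (fun q : ℝ × X => F q.1 q.2) (Ici 0 ×ˢ D)) {t₀ T : ℝ} (ht₀ : 0 ≤ t₀)
    (hT : t₀ < T) {s : ℝ → X} (hs : IsSolution F M (Ico t₀ T) s) (h0 : s t₀ ∈ D) :
    ∃ s', IsSolution F M (Icc t₀ T) s' ∧ EqOn s s' (Ico t₀ T) ∧ s' T ∈ D := by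
  set K := {x | x ∈ D ∧ V x ≤ V (s t₀)} with hK
  have hKc : IsCompact K := hV.isCompact_sublevel _
  have hsK : ∀ t ∈ Ico t₀ T, s t ∈ K := fun t ht =>
    (hs.mono (Icc_subset_Ico_right ht.2)).mem_and_le hV hO hDO ht₀ h0 t ⟨ht.1, le_rfl⟩
  have hsubK : Icc t₀ T ×ˢ K ⊆ Ici 0 ×ˢ D :=
    prod_mono (fun t ht => ht₀.trans ht.1) fun x hx => hx.1
  obtain ⟨C, hC⟩ := (isCompact_Icc.prod hKc).exists_bound_of_continuousOn (hF.mono hsubK)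
  have hLip : LipschitzOnWith C.toNNReal s (Ico t₀ T) :=
    (convex_Ico t₀ T).lipschitzOnWith_of_nnnorm_hasDerivWithin_le (fun t ht => (hs t ht).2)
      fun t ht => by
        rw [← NNReal.coe_le_coe, coe_nnnorm]
        exact (hC (t, s t) ⟨⟨ht.1, ht.2.le⟩, hsK t ht⟩).trans (Real.le_coe_toNNReal C)
  obtain ⟨g, hgL, hgs⟩ := hLip.extend_finite_dimension
  have hgc : Continuous g := hgL.continuous
  have hgsol : IsSolution F M (Ico t₀ T) g := hs.congr hgs.symm
  have hTK : g T ∈ K := by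
    refine hKc.isClosed.mem_of_tendsto (b := 𝓝[<] T)
      (hgc.continuousAt.mono_left nhdsWithin_le_nhds) ?_
    filter_upwards [Ioo_mem_nhdsLT hT] with t ht
    rw [← hgs ⟨ht.1.le, ht.2⟩]
    exact hsK t ⟨ht.1.le, ht.2⟩
  refine ⟨g, fun t ht => ?_, hgs, hTK.1⟩
  rcases ht.2.eq_or_lt with rfl | hlt
  · refine ⟨by have := hTK.1; rw [hDO] at this; exact this.1, ?_⟩
    have hd : ∀ r ∈ Ioo t₀ t, HasDerivAt g (F r (g r)) r := fun r hr =>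
      (hgsol r ⟨hr.1.le, hr.2⟩).2.hasDerivAt (Ico_mem_nhds hr.1 hr.2)
    refine (hasDerivWithinAt_Iic_of_tendsto_deriv (s := Ioo t₀ t)
      (fun r hr => (hd r hr).differentiableAt.differentiableWithinAt)
      hgc.continuousWithinAt (Ioo_mem_nhdsLT hT) ?_).mono fun r hr => hr.2
    have h1 : Tendsto (fun r => F r (g r)) (𝓝[<] t) (𝓝 (F t (g t))) := by
      have h2 := hF (t, g t) ⟨ht₀.trans hT.le, hTK.1⟩
      refine h2.tendsto.comp (f := fun r => (r, g r)) (tendsto_nhdsWithin_iff.2 ⟨?_, ?_⟩)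
      · exact (continuous_id.prodMk hgc).continuousAt.mono_left nhdsWithin_le_nhds
      · filter_upwards [Ioo_mem_nhdsLT hT] with r hr
        refine ⟨ht₀.trans hr.1.le, ?_⟩
        rw [← hgs ⟨hr.1.le, hr.2⟩]
        exact (hsK r ⟨hr.1.le, hr.2⟩).1
    refine h1.congr' ?_
    filter_upwards [Ioo_mem_nhdsLT hT] with r hr
    exact (hd r hr).deriv.symm
  · refine ⟨(hgsol t ⟨ht.1, hlt⟩).1, (hgsol t ⟨ht.1, hlt⟩).2.mono_of_mem_nhdsWithin ?_⟩
    refine mem_of_superset (inter_mem_nhdsWithin _ (Iio_mem_nhds hlt)) fun r hr => ⟨hr.1.1, hr.2⟩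

/-- A sublevel set of a Lyapunov function with a sufficiently small level is as close to `A`
as required. -/
theorem IsLyapunovFunction.exists_infDist_lt (hV : IsLyapunovFunction F A D V) {ε : ℝ}
    (hε : 0 < ε) :
    ∃ c > 0, ∀ x ∈ D, V x < c → Metric.infDist x A < ε := by
  set K := {x | x ∈ D ∧ V x ≤ 1} ∩ {x | ε ≤ Metric.infDist x A} with hK
  have hKc : IsCompact K := (hV.isCompact_sublevel 1).inter_right
    (isClosed_le continuous_const (Metric.continuous_infDist_pt A))
  rcases K.eq_empty_or_nonempty with he | hne
  · refine ⟨1, one_pos, fun x hx hlt => ?_⟩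
    by_contra! hcon
    exact (he ▸ (show x ∈ K from ⟨⟨hx, hlt.le⟩, hcon⟩) : x ∈ (∅ : Set X))
  · obtain ⟨x₁, hx₁, hmin⟩ := hKc.exists_isMinOn hne
      (fun x hx => (hV.contDiffAt x hx.1.1).continuousAt.continuousWithinAt)
    have hx₁A : x₁ ∉ A := fun h => by
      have := hx₁.2
      rw [mem_ofPred_eq, Metric.infDist_zero_of_mem h] at this
      linarith
    refine ⟨min 1 (V x₁), lt_min one_pos (hV.pos x₁ ⟨hx₁.1.1, hx₁A⟩), fun x hx hlt => ?_⟩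
    by_contra! hcon
    have := hmin (show x ∈ K from ⟨⟨hx, (hlt.trans_le (min_le_left _ _)).le⟩, hcon⟩)
    exact absurd (hlt.trans_le (min_le_right _ _)) (not_lt.2 this)

end Lyapunov

/-! ### Vectors, matrices and rotations of Euclidean three-space -/

section Coordinates

theorem act_apply (A : Mat3) (x : E3) (i : Fin 3) :
    act A x i = A i 0 * x 0 + A i 1 * x 1 + A i 2 * x 2 := by
  simp [act, Matrix.toLpLin_apply, Matrix.mulVec, dotProduct, Fin.sum_univ_three]

theorem inner_eq (x y : E3) : inner ℝ x y = x 0 * y 0 + x 1 * y 1 + x 2 * y 2 := by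
  simp [PiLp.inner_apply, Fin.sum_univ_three, mul_comm]

theorem norm_sq_eq (x : E3) : ‖x‖ ^ 2 = x 0 ^ 2 + x 1 ^ 2 + x 2 ^ 2 := by
  rw [← real_inner_self_eq_norm_sq, inner_eq]
  ring

theorem E3_ext {x y : E3} (h0 : x 0 = y 0) (h1 : x 1 = y 1) (h2 : x 2 = y 2) : x = y := by
  ext i
  fin_cases i <;> assumption

@[simp] theorem zeta_apply_zero : zeta 0 = 0 := by simp [zeta]
@[simp] theorem zeta_apply_one : zeta 1 = 0 := by simp [zeta]
@[simp] theorem zeta_apply_two : zeta 2 = 1 := by simp [zeta]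

@[simp] theorem act_skew_zero (a b : E3) : act (skew a) b 0 = a 1 * b 2 - a 2 * b 1 := by
  rw [act_apply]; simp [skew]; ring

@[simp] theorem act_skew_one (a b : E3) : act (skew a) b 1 = a 2 * b 0 - a 0 * b 2 := by
  rw [act_apply]; simp [skew]; ring

@[simp] theorem act_skew_two (a b : E3) : act (skew a) b 2 = a 0 * b 1 - a 1 * b 0 := by
  rw [act_apply]; simp [skew]; ring

@[simp] theorem act_proj_zero (a : E3) : act proj a 0 = a 0 := by
  rw [act_apply]; simp [proj, Matrix.vecMulVec_apply]

@[simp] theorem act_proj_one (a : E3) : act proj a 1 = a 1 := by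
  rw [act_apply]; simp [proj, Matrix.vecMulVec_apply]

@[simp] theorem act_proj_two (a : E3) : act proj a 2 = 0 := by
  rw [act_apply]; simp [proj, Matrix.vecMulVec_apply]

theorem inner_zeta (x : E3) : inner ℝ zeta x = x 2 := by
  simp [inner_eq]

theorem norm_zeta : ‖zeta‖ = 1 := by
  have := norm_sq_eq zeta
  simp only [zeta_apply_zero, zeta_apply_one, zeta_apply_two] at this
  nlinarith [norm_nonneg zeta]

/-- The product of a matrix and a vector, as a continuous bilinear map. -/
noncomputable def actL : Mat3 →L[ℝ] E3 →L[ℝ] E3 :=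
  LinearMap.toContinuousBilinearMap <| LinearMap.mk₂ ℝ act
    (fun A B x => by simp [act]) (fun c A x => by simp [act])
    (fun A x y => by simp [act]) (fun c A x => by simp [act])

theorem actL_apply (A : Mat3) (x : E3) : actL A x = act A x := rfl

/-- The map `v ↦ [v]ₓ`, as a continuous linear map. -/
noncomputable def skewL : E3 →L[ℝ] Mat3 :=
  LinearMap.toContinuousLinearMap
    { toFun := skew
      map_add' := fun x y => by
        ext i j
        fin_cases i <;> fin_cases j <;> simp [skew] <;> ring
      map_smul' := fun c x => by
        ext i j
        fin_cases i <;> fin_cases j <;> simp [skew] }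

theorem skewL_apply (v : E3) : skewL v = skew v := rfl

/-- Transposition, as a continuous linear map. -/
noncomputable def transposeL : Mat3 →L[ℝ] Mat3 :=
  LinearMap.toContinuousLinearMap (Matrix.transposeLinearEquiv (Fin 3) (Fin 3) ℝ ℝ).toLinearMap

theorem transposeL_apply (A : Mat3) : transposeL A = A.transpose := rfl

/-- The matrix product, as a continuous bilinear map. -/
noncomputable def mulL : Mat3 →L[ℝ] Mat3 →L[ℝ] Mat3 :=
  LinearMap.toContinuousBilinearMap (LinearMap.mul ℝ Mat3)

theorem mulL_apply (A B : Mat3) : mulL A B = A * B := rfl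

/-- An entry of a matrix, as a continuous linear functional. -/
noncomputable def entryL (i j : Fin 3) : Mat3 →L[ℝ] ℝ :=
  LinearMap.toContinuousLinearMap (Matrix.entryLinearMap ℝ ℝ i j)

theorem inner_act_transpose (A : Mat3) (x y : E3) :
    inner ℝ (act A.transpose x) y = inner ℝ x (act A y) := by
  simp only [inner_eq, act_apply, Matrix.transpose_apply]
  ring

theorem mem_SO3_iff {R : Mat3} : R ∈ SO3 ↔ R.transpose * R = 1 ∧ R.det = 1 := by
  rw [SO3, mem_ofPred_eq, Matrix.mem_specialOrthogonalGroup_iff, Matrix.mem_orthogonalGroup_iff']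

theorem inner_columns_of_mem_SO3 {R : Mat3} (hR : R ∈ SO3) (i j : Fin 3) :
    R 0 i * R 0 j + R 1 i * R 1 j + R 2 i * R 2 j = if i = j then 1 else 0 := by
  have := congrFun (congrFun (mem_SO3_iff.1 hR).1 i) j
  simpa [Matrix.mul_apply, Fin.sum_univ_three, Matrix.one_apply] using this

theorem norm_of_mem_SO3 {R : Mat3} (hR : R ∈ SO3) : ‖R‖ = √3 := by
  rw [Matrix.frobenius_norm_def, ← Real.sqrt_eq_rpow]
  congr 1
  have h0 := inner_columns_of_mem_SO3 hR 0 0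
  have h1 := inner_columns_of_mem_SO3 hR 1 1
  have h2 := inner_columns_of_mem_SO3 hR 2 2
  simp only [if_true] at h0 h1 h2
  simp only [Fin.sum_univ_three, Real.norm_eq_abs, Real.rpow_two, sq_abs]
  linarith

theorem isCompact_SO3 : IsCompact SO3 := by
  refine Metric.isCompact_of_isClosed_isBounded ?_
    ((Metric.isBounded_closedBall (x := (0 : Mat3)) (r := √3)).subset fun R hR => by
      simp [norm_of_mem_SO3 hR])
  have h1 : SO3 = {R : Mat3 | mulL (transposeL R) R = 1} ∩ {R : Mat3 |
      entryL 0 0 R * entryL 1 1 R * entryL 2 2 R - entryL 0 0 R * entryL 1 2 R * entryL 2 1 R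
      - entryL 0 1 R * entryL 1 0 R * entryL 2 2 R + entryL 0 1 R * entryL 1 2 R * entryL 2 0 R
      + entryL 0 2 R * entryL 1 0 R * entryL 2 1 R
      - entryL 0 2 R * entryL 1 1 R * entryL 2 0 R = 1} := by
    ext R
    rw [mem_SO3_iff, Matrix.det_fin_three]
    rfl
  rw [h1]
  refine IsClosed.inter (isClosed_eq ?_ continuous_const) (isClosed_eq ?_ continuous_const)
  · exact mulL.continuous₂.comp (transposeL.continuous.prodMk continuous_id)
  · fun_prop

theorem inner_act_of_mem_SO3 {R : Mat3} (hR : R ∈ SO3) (x y : E3) :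
    inner ℝ (act R x) (act R y) = inner ℝ x y := by
  have h := fun i j => inner_columns_of_mem_SO3 hR i j
  have h00 := h 0 0
  have h01 := h 0 1
  have h02 := h 0 2
  have h11 := h 1 1
  have h12 := h 1 2
  have h22 := h 2 2
  simp only [if_true, Fin.reduceEq, if_false] at h00 h01 h02 h11 h12 h22
  simp only [inner_eq, act_apply]
  linear_combination x 0 * y 0 * h00 + (x 0 * y 1 + x 1 * y 0) * h01
    + (x 0 * y 2 + x 2 * y 0) * h02 + x 1 * y 1 * h11 + (x 1 * y 2 + x 2 * y 1) * h12
    + x 2 * y 2 * h22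

theorem norm_act_of_mem_SO3 {R : Mat3} (hR : R ∈ SO3) (x : E3) : ‖act R x‖ = ‖x‖ := by
  rw [← sq_eq_sq₀ (norm_nonneg _) (norm_nonneg _), ← real_inner_self_eq_norm_sq,
    ← real_inner_self_eq_norm_sq, inner_act_of_mem_SO3 hR]

theorem transpose_mem_SO3 {R : Mat3} (hR : R ∈ SO3) : R.transpose ∈ SO3 := by
  rw [mem_SO3_iff] at hR ⊢
  refine ⟨?_, by rw [Matrix.det_transpose]; exact hR.2⟩
  rw [Matrix.transpose_transpose]
  exact mul_eq_one_comm.1 hR.1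

/-- Rotations respect the cross product: a rotation matrix is its own matrix of cofactors. -/
theorem act_act_skew_of_mem_SO3 {R : Mat3} (hR : R ∈ SO3) (a b : E3) :
    act R (act (skew a) b) = act (skew (act R a)) (act R b) := by
  have hadj : R.adjugate = R.transpose := by
    obtain ⟨h1, h2⟩ := mem_SO3_iff.1 hR
    calc R.adjugate = R.transpose * R * R.adjugate := by rw [h1, one_mul]
      _ = R.transpose := by rw [mul_assoc, Matrix.mul_adjugate, h2, one_smul, mul_one]
  rw [Matrix.adjugate_fin_three] at hadj
  have h := fun i j => congrFun (congrFun hadj i) j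
  have h00 := h 0 0
  have h01 := h 0 1
  have h02 := h 0 2
  have h10 := h 1 0
  have h11 := h 1 1
  have h12 := h 1 2
  have h20 := h 2 0
  have h21 := h 2 1
  have h22 := h 2 2
  simp only [Matrix.of_apply, Matrix.cons_val_zero, Matrix.cons_val_one, Matrix.cons_val,
    Matrix.cons_val', Matrix.transpose_apply] at h00 h01 h02 h10 h11 h12 h20 h21 h22
  have e := fun i => act_apply R (act (skew a) b) i
  simp only [act_skew_zero, act_skew_one, act_skew_two] at e
  refine E3_ext ?_ ?_ ?_
  · rw [e, act_skew_zero]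
    simp only [act_apply]
    linear_combination -((a 1 * b 2 - a 2 * b 1) * h00 + (a 2 * b 0 - a 0 * b 2) * h10
      + (a 0 * b 1 - a 1 * b 0) * h20)
  · rw [e, act_skew_one]
    simp only [act_apply]
    linear_combination -((a 1 * b 2 - a 2 * b 1) * h01 + (a 2 * b 0 - a 0 * b 2) * h11
      + (a 0 * b 1 - a 1 * b 0) * h21)
  · rw [e, act_skew_two]
    simp only [act_apply]
    linear_combination -((a 1 * b 2 - a 2 * b 1) * h02 + (a 2 * b 0 - a 0 * b 2) * h12
      + (a 0 * b 1 - a 1 * b 0) * h22)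

theorem inner_act_skew_self (a b : E3) : inner ℝ a (act (skew a) b) = 0 := by
  simp only [inner_eq, act_skew_zero, act_skew_one, act_skew_two]
  ring

end Coordinates

/-! ### Invariance of the sphere and of the rotation group -/

section Invariance

theorem neg_skew_mul_apply (w : E3) (R : Mat3) (j : Fin 3) :
    (-(skew w * R)) 0 j = w 2 * R 1 j - w 1 * R 2 j ∧
    (-(skew w * R)) 1 j = w 0 * R 2 j - w 2 * R 0 j ∧
    (-(skew w * R)) 2 j = w 1 * R 0 j - w 0 * R 1 j := by
  refine ⟨?_, ?_, ?_⟩ <;> rw [Matrix.neg_apply, Matrix.mul_apply, Fin.sum_univ_three] <;>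
    simp [skew] <;> ring

theorem eq_of_hasDerivWithinAt_zero {E : Type*} [NormedAddCommGroup E] [NormedSpace ℝ E]
    {f : ℝ → E} {a b : ℝ} (hf : ∀ t ∈ Icc a b, HasDerivWithinAt f 0 (Icc a b) t) :
    ∀ t ∈ Icc a b, f t = f a := fun t ht => by
  have := (convex_Icc a b).norm_image_sub_le_of_norm_hasDerivWithin_le (C := 0) hf (by simp)
    ⟨le_rfl, ht.1.trans ht.2⟩ ht
  simpa [sub_eq_zero] using this

theorem norm_eq_of_hasDerivWithinAt_skew {x e : ℝ → E3} {a b : ℝ}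
    (hx : ∀ t ∈ Icc a b, HasDerivWithinAt x (act (skew (x t)) (e t)) (Icc a b) t) :
    ∀ t ∈ Icc a b, ‖x t‖ = ‖x a‖ := fun t ht => by
  rw [← sq_eq_sq₀ (norm_nonneg _) (norm_nonneg _)]
  refine eq_of_hasDerivWithinAt_zero (f := fun t => ‖x t‖ ^ 2) (fun r hr => ?_) t ht
  simpa [inner_act_skew_self] using (hx r hr).norm_sq

theorem mem_SO3_of_hasDerivWithinAt {R : ℝ → Mat3} {w : ℝ → E3} {a b : ℝ}
    (hR : ∀ t ∈ Icc a b, HasDerivWithinAt R (-(skew (w t) * R t)) (Icc a b) t)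
    (h0 : R a ∈ SO3) : ∀ t ∈ Icc a b, R t ∈ SO3 := fun t ht => by
  have he : ∀ i j, ∀ t ∈ Icc a b,
      HasDerivWithinAt (fun r => R r i j) ((-(skew (w t) * R t)) i j) (Icc a b) t :=
    fun i j t ht => (entryL i j).hasFDerivAt.comp_hasDerivWithinAt t (hR t ht)
  rw [mem_SO3_iff] at h0 ⊢
  constructor
  · rw [← h0.1]
    ext i j
    refine eq_of_hasDerivWithinAt_zero (f := fun t => ((R t).transpose * R t) i j)
      (fun r hr => ?_) t ht
    have := (((he 0 i r hr).mul (he 0 j r hr)).add ((he 1 i r hr).mul (he 1 j r hr))).add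
      ((he 2 i r hr).mul (he 2 j r hr))
    refine (this.congr_deriv ?_).congr_of_eventuallyEq (.of_forall fun q => ?_) ?_
    · simp only [neg_skew_mul_apply]
      ring
    · simp [Matrix.mul_apply, Fin.sum_univ_three]
    · simp [Matrix.mul_apply, Fin.sum_univ_three]
  · rw [← h0.2]
    refine eq_of_hasDerivWithinAt_zero (f := fun t => (R t).det) (fun r hr => ?_) t ht
    have h := fun i j => he i j r hr
    have := (((((((h 0 0).mul (h 1 1)).mul (h 2 2)).sub (((h 0 0).mul (h 1 2)).mul (h 2 1))).sub
      (((h 0 1).mul (h 1 0)).mul (h 2 2))).add (((h 0 1).mul (h 1 2)).mul (h 2 0))).add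
      (((h 0 2).mul (h 1 0)).mul (h 2 1))).sub (((h 0 2).mul (h 1 1)).mul (h 2 0))
    refine (this.congr_deriv ?_).congr_of_eventuallyEq (.of_forall fun q => ?_) ?_
    · simp only [neg_skew_mul_apply, Pi.mul_apply]
      ring
    · simp [Matrix.det_fin_three]
    · simp [Matrix.det_fin_three]

end Invariance

/-! ### The derivative of the composite Lyapunov function -/

section CompositeLyapunov

theorem x2Dot_eq {v d : E3} (hv : v ≠ 0) (x₃ : E3) (R : Mat3) :
    x2Dot v d ‖v‖ x₃ R = v - d + ‖v‖ • act R.transpose (zeta - x₃) := by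
  rw [x2Dot, div_self (norm_ne_zero_iff.2 hv), one_smul]

theorem inner_gradient_snd {f : E3 × E3 → ℝ} (hf : Differentiable ℝ f) (x y w : E3) :
    inner ℝ (gradient (fun z => f (x, z)) y) w = fderiv ℝ f (x, y) (0, w) := by
  have h : HasFDerivAt (fun z => f (x, z))
      ((fderiv ℝ f (x, y)).comp (ContinuousLinearMap.inr ℝ E3 E3)) y :=
    (hf (x, y)).hasFDerivAt.comp y (hasFDerivAt_prodMk_right x y)
  rw [inner_gradient_left, h.fderiv]
  simp

theorem coord_bounds_of_norm_eq_one {x : E3} (hx : ‖x‖ = 1) : -1 ≤ x 2 ∧ x 2 ≤ 1 := by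
  have := norm_sq_eq x
  rw [hx] at this
  constructor <;> nlinarith [sq_nonneg (x 0), sq_nonneg (x 1)]

theorem norm_zeta_sub_sq {x : E3} (hx : ‖x‖ = 1) : ‖zeta - x‖ ^ 2 = 2 * (1 - x 2) := by
  rw [norm_sub_sq_real, hx, norm_zeta, inner_zeta]
  ring

theorem eq_neg_zeta_iff {x : E3} (hx : ‖x‖ = 1) : x = -zeta ↔ 1 + x 2 = 0 := by
  refine ⟨fun h => by simp [h], fun h => ?_⟩
  have := norm_sq_eq x
  rw [hx, show x 2 = -1 by linarith] at this
  have h0 : x 0 = 0 := by nlinarith [sq_nonneg (x 0), sq_nonneg (x 1)]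
  have h1 : x 1 = 0 := by nlinarith [sq_nonneg (x 0), sq_nonneg (x 1)]
  refine E3_ext ?_ ?_ ?_
  · simp [h0]
  · simp [h1]
  · simp
    linarith

theorem eq_zeta_of_coord {x : E3} (hx : ‖x‖ = 1) (h : x 2 = 1) : x = zeta := by
  have := norm_zeta_sub_sq hx
  rw [h, sub_self, mul_zero, sq_eq_zero_iff, norm_eq_zero, sub_eq_zero] at this
  exact this.symm

theorem one_add_coord_pos_of_mem_setD {s : State} (hs : s ∈ setD) : 0 < 1 + s.2.2.1 2 := by
  have h1 := (coord_bounds_of_norm_eq_one hs.1).1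
  have h2 := mt (eq_neg_zeta_iff hs.1).2 hs.2.1
  exact lt_of_le_of_ne (by linarith) (Ne.symm h2)

/-- The derivative of `z = ζᵀx₃` for the angular velocity law: `κ (1 - z²)` plus the multiple of
`(ζ - x₃)ᵀλ` that compensates the coupling term in the derivative of `V_ξ`. The component `ψ` about
the thrust axis and the feedforward `p` have no influence. -/
theorem skew_betaTerm_coord {k₂ c : ℝ} (hc : 0 < c) {x₃ : E3} (hx : ‖x₃‖ = 1)
    (lam p : E3) (κ ψ : ℝ) :
    act (skew x₃) (ψ • zeta + act proj (p + act (skew zeta) (κ • x₃ + betaTerm k₂ c x₃ lam)) - p) 2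
      = κ * (1 - x₃ 2 ^ 2) + k₂ * (1 + x₃ 2) ^ 2 * inner ℝ (zeta - x₃) lam := by
  have hn := norm_sq_eq x₃
  rw [hx] at hn
  have hz := (coord_bounds_of_norm_eq_one hx).2
  have hΔ : 1 - x₃ 2 + c ≠ 0 := by linarith
  simp only [betaTerm, inner_zeta]
  simp only [inner_eq, act_skew_two, act_skew_one, act_skew_zero, PiLp.add_apply, PiLp.sub_apply,
    PiLp.smul_apply, smul_eq_mul, act_proj_zero, act_proj_one, act_proj_two, zeta_apply_zero,
    zeta_apply_one, zeta_apply_two]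
  rw [div_eq_mul_inv, div_eq_mul_inv]
  have hi := inv_mul_cancel₀ hΔ
  set i := (1 - x₃ 2 + c)⁻¹
  set q := x₃ 0 * lam 0 + x₃ 1 * lam 1
  linear_combination -(κ + k₂ * (1 + x₃ 2) * lam 2 - k₂ * (1 + x₃ 2) * q * i) * hn
    - k₂ * (1 + x₃ 2) ^ 2 * q * hi

theorem hasFDerivAt_compositeV {Vξ : E3 × E3 → ℝ} (hV : Differentiable ℝ Vξ) {k₂ : ℝ}
    (hk₂ : k₂ ≠ 0) {s : State} (hs : 1 + s.2.2.1 2 ≠ 0) :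
    ∃ L : State →L[ℝ] ℝ, HasFDerivAt (compositeV Vξ k₂) L s ∧
      ∀ w : State, L w = fderiv ℝ Vξ (s.1, s.2.1) (w.1, w.2.1)
        - w.2.2.1 2 / (k₂ * (1 + s.2.2.1 2) ^ 2) := by
  have h1 : HasFDerivAt (fun s : State => (s.1, s.2.1)) ((ContinuousLinearMap.fst ℝ _ _).prod
      ((ContinuousLinearMap.fst ℝ _ _).comp (ContinuousLinearMap.snd ℝ _ _))) s :=
    hasFDerivAt_fst.prodMk (hasFDerivAt_fst.comp s hasFDerivAt_snd)
  have h2 := (hV (s.1, s.2.1)).hasFDerivAt.comp s h1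
  let z : State →L[ℝ] ℝ := (innerSL ℝ zeta).comp ((ContinuousLinearMap.fst ℝ E3 Mat3).comp
    ((ContinuousLinearMap.snd ℝ E3 (E3 × Mat3)).comp
      (ContinuousLinearMap.snd ℝ E3 (E3 × E3 × Mat3))))
  have hz : ∀ w : State, z w = w.2.2.1 2 := fun w => inner_zeta _
  have h3 : HasDerivAt (fun r : ℝ => (1 - r) / (2 * k₂ * (1 + r)))
      (-1 / (k₂ * (1 + s.2.2.1 2) ^ 2)) (z s) := by
    have hne : 2 * k₂ * (1 + z s) ≠ 0 := by
      rw [hz]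
      positivity
    have := ((hasDerivAt_id (z s)).const_sub 1).div
      (((hasDerivAt_id (z s)).const_add 1).const_mul (2 * k₂)) hne
    refine this.congr_deriv ?_
    rw [hz] at *
    simp only [id]
    field_simp
    ring
  refine ⟨_, h2.add (h3.comp_hasFDerivAt s z.hasFDerivAt), fun w => ?_⟩
  change fderiv ℝ Vξ (s.1, s.2.1) (w.1, w.2.1) + (-1 / (k₂ * (1 + s.2.2.1 2) ^ 2)) * z w = _
  rw [hz]
  ring

variable {u : E3 × E3 × E3 → E3} {Vξ : E3 × E3 → ℝ} {d : ℝ → E3} {k₂ c : ℝ}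
  {κ₁ ψ : ℝ → State → ℝ}

/-- The derivative of the composite function along the closed loop. The term `β` cancels the
coupling between attitude and translation. -/
theorem fderiv_compositeV_closedLoop (hV : Differentiable ℝ Vξ) (hk₂ : k₂ ≠ 0) (hc : 0 < c)
    {t : ℝ} {s : State} (hs : s ∈ setD) (hu : virtualControl u d t s ≠ 0) :
    fderiv ℝ (compositeV Vξ k₂) s (closedLoop u Vξ d k₂ c κ₁ ψ t s) =
      fderiv ℝ Vξ (s.1, s.2.1) (doubleIntegrator u d t (s.1, s.2.1))
        - κ₁ t s / k₂ * ((1 - s.2.2.1 2) / (1 + s.2.2.1 2)) := by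
  have hz := one_add_coord_pos_of_mem_setD hs
  obtain ⟨L, hL, hLw⟩ := hasFDerivAt_compositeV hV hk₂ hz.ne'
  rw [hL.fderiv, hLw]
  simp only [closedLoop, errorDynamics, angularVelocity]
  rw [skew_betaTerm_coord hc hs.1, thrust, x2Dot_eq hu]
  set v := virtualControl u d t s with hv
  have hlam : inner ℝ (zeta - s.2.2.1) (lambdaTerm Vξ v s) =
      fderiv ℝ Vξ (s.1, s.2.1) (0, ‖v‖ • act s.2.2.2.transpose (zeta - s.2.2.1)) := by
    rw [lambdaTerm, ← inner_gradient_snd hV, inner_smul_right, inner_smul_right,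
      ← inner_act_transpose, real_inner_comm]
  have hsplit : fderiv ℝ Vξ (s.1, s.2.1)
      (s.2.1, v - d t + ‖v‖ • act s.2.2.2.transpose (zeta - s.2.2.1)) =
      fderiv ℝ Vξ (s.1, s.2.1) (doubleIntegrator u d t (s.1, s.2.1)) +
      fderiv ℝ Vξ (s.1, s.2.1) (0, ‖v‖ • act s.2.2.2.transpose (zeta - s.2.2.1)) := by
    rw [← map_add]
    congr 1
    simp [doubleIntegrator, hv, virtualControl]
  rw [hsplit, hlam]
  field_simp
  ring

end CompositeLyapunov

/-! ### The composite function is a Lyapunov function -/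

section CompositeIsLyapunov

variable {u : E3 × E3 × E3 → E3} {Vξ : E3 × E3 → ℝ} {d : ℝ → E3} {k₁ k₂ c : ℝ}
  {κ₁ ψ : ℝ → State → ℝ} {F : ℝ → E3 × E3 → E3 × E3}

theorem IsLyapunovFunction.contDiff (hV : IsLyapunovFunction F {0} univ Vξ) :
    ContDiff ℝ 1 Vξ := contDiff_iff_contDiffAt.2 fun ξ => hV.contDiffAt ξ (mem_univ _)

theorem IsLyapunovFunction.differentiable (hV : IsLyapunovFunction F {0} univ Vξ) :
    Differentiable ℝ Vξ := hV.contDiff.differentiable one_ne_zero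

theorem IsLyapunovFunction.nonneg (hV : IsLyapunovFunction F {0} univ Vξ) (ξ : E3 × E3) :
    0 ≤ Vξ ξ := by
  by_cases h : ξ = 0
  · exact (hV.eq_zero ξ h).ge
  · exact (hV.pos ξ ⟨mem_univ _, h⟩).le

theorem compositeV_eq (s : State) :
    compositeV Vξ k₂ s =
      Vξ (s.1, s.2.1) + (1 - s.2.2.1 2) / (1 + s.2.2.1 2) / (2 * k₂) := by
  rw [compositeV, inner_zeta, div_div, mul_comm (2 * k₂)]

theorem attitudeError_nonneg {s : State} (hs : s ∈ setD) :
    0 ≤ (1 - s.2.2.1 2) / (1 + s.2.2.1 2) :=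
  div_nonneg (by linarith [(coord_bounds_of_norm_eq_one hs.1).2])
    (one_add_coord_pos_of_mem_setD hs).le

theorem le_compositeV (hk₂ : 0 < k₂) {s : State} (hs : s ∈ setD) :
    Vξ (s.1, s.2.1) ≤ compositeV Vξ k₂ s := by
  rw [compositeV_eq]
  have := div_nonneg (attitudeError_nonneg hs) (by positivity : 0 ≤ 2 * k₂)
  linarith

/-- In the variables without denominators the sublevel sets of the composite function are closed in
the whole state space, since the points with `x₃ = -ζ` are excluded by the inequality itself. -/
theorem sublevel_compositeV_eq (hk₂ : 0 < k₂) (r : ℝ) :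
    {s : State | s ∈ setD ∧ compositeV Vξ k₂ s ≤ r} =
      {s : State | ‖s.2.2.1‖ = 1 ∧ s.2.2.2 ∈ SO3 ∧
        2 * k₂ * Vξ (s.1, s.2.1) * (1 + s.2.2.1 2) + (1 - s.2.2.1 2)
          ≤ 2 * k₂ * r * (1 + s.2.2.1 2)} := by
  have key : ∀ s ∈ setD, compositeV Vξ k₂ s ≤ r ↔
      2 * k₂ * Vξ (s.1, s.2.1) * (1 + s.2.2.1 2) + (1 - s.2.2.1 2)
          ≤ 2 * k₂ * r * (1 + s.2.2.1 2) := fun s hs => by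
    have hz := one_add_coord_pos_of_mem_setD hs
    rw [compositeV_eq, ← mul_le_mul_iff_of_pos_left (by positivity : 0 < 2 * k₂ * (1 + s.2.2.1 2))]
    have h1 : 2 * k₂ * (1 + s.2.2.1 2) *
        (Vξ (s.1, s.2.1) + (1 - s.2.2.1 2) / (1 + s.2.2.1 2) / (2 * k₂)) =
        2 * k₂ * Vξ (s.1, s.2.1) * (1 + s.2.2.1 2) + (1 - s.2.2.1 2) := by
      field_simp
    rw [h1]
    constructor <;> intro h <;> linarith
  ext s
  refine ⟨fun hs => ⟨hs.1.1, hs.1.2.2, (key s hs.1).1 hs.2⟩, fun hs => ?_⟩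
  have hD : s ∈ setD := by
    refine ⟨hs.1, fun h => ?_, hs.2.1⟩
    have := hs.2.2
    rw [(eq_neg_zeta_iff hs.1).1 h] at this
    have h2 := (eq_neg_zeta_iff hs.1).1 h
    linarith
  exact ⟨hD, (key s hD).2 hs.2.2⟩

theorem isCompact_sublevel_compositeV (hV : IsLyapunovFunction F {0} univ Vξ) (hk₂ : 0 < k₂)
    (r : ℝ) : IsCompact {s : State | s ∈ setD ∧ compositeV Vξ k₂ s ≤ r} := by
  have hVc := hV.contDiff.continuous
  have hcoord : Continuous fun s : State => s.2.2.1 2 := by fun_prop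
  have hVs : Continuous fun s : State => Vξ (s.1, s.2.1) := by fun_prop
  -- the map `(ξ, x₃, R) ↦ (x₁, x₂, x₃, R)`
  have hK : IsCompact ((fun q : (E3 × E3) × E3 × Mat3 => ((q.1.1, q.1.2, q.2.1, q.2.2) : State)) ''
      ({ξ | ξ ∈ univ ∧ Vξ ξ ≤ r} ×ˢ Metric.closedBall 0 1 ×ˢ SO3)) :=
    ((hV.isCompact_sublevel r).prod ((isCompact_closedBall 0 1).prod isCompact_SO3)).image
      (by fun_prop)
  refine hK.of_isClosed_subset ?_ fun s hs => ?_
  · rw [sublevel_compositeV_eq hk₂]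
    have h1 : IsClosed {s : State | ‖s.2.2.1‖ = 1} := isClosed_eq (by fun_prop) continuous_const
    have h2 : IsClosed {s : State | s.2.2.2 ∈ SO3} :=
      isCompact_SO3.isClosed.preimage (by fun_prop : Continuous fun s : State => s.2.2.2)
    have h3 : IsClosed {s : State | 2 * k₂ * Vξ (s.1, s.2.1) * (1 + s.2.2.1 2) + (1 - s.2.2.1 2)
        ≤ 2 * k₂ * r * (1 + s.2.2.1 2)} :=
      isClosed_le (((continuous_const.mul hVs).mul (continuous_const.add hcoord)).add
        (continuous_const.sub hcoord)) (continuous_const.mul (continuous_const.add hcoord))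
    exact h1.inter (h2.inter h3)
  · exact ⟨((s.1, s.2.1), s.2.2.1, s.2.2.2),
      ⟨⟨mem_univ _, (le_compositeV hk₂ hs.1).trans hs.2⟩, by simp [hs.1.1], hs.1.2.2⟩, rfl⟩

theorem contDiffAt_compositeV (hV : ContDiff ℝ 1 Vξ) (hk₂ : k₂ ≠ 0) {s : State} (hs : s ∈ setD) :
    ContDiffAt ℝ 1 (compositeV Vξ k₂) s := by
  have hz := one_add_coord_pos_of_mem_setD hs
  have h1 : ContDiff ℝ 1 fun s : State => Vξ (s.1, s.2.1) := by fun_prop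
  have h2 : ContDiff ℝ 1 fun s : State => inner ℝ zeta s.2.2.1 :=
    (innerSL ℝ zeta).contDiff.comp (by fun_prop)
  refine h1.contDiffAt.add ((contDiff_const.sub h2).contDiffAt.div
    (contDiff_const.mul (contDiff_const.add h2)).contDiffAt ?_)
  rw [inner_zeta]
  positivity

theorem closedLoop_deriv_le (hV : Differentiable ℝ Vξ) (hk₂ : 0 < k₂) (hc : 0 < c)
    (hκk : ∀ t : ℝ, 0 ≤ t → ∀ s ∈ setD, k₁ ≤ κ₁ t s)
    (hu : ∀ t : ℝ, 0 ≤ t → ∀ ξ₁ ξ₂ : E3, u (ξ₁, ξ₂, d t) ≠ 0) {t : ℝ} (ht : 0 ≤ t) {s : State}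
    (hs : s ∈ setD) :
    fderiv ℝ (compositeV Vξ k₂) s (closedLoop u Vξ d k₂ c κ₁ ψ t s) ≤
      fderiv ℝ Vξ (s.1, s.2.1) (doubleIntegrator u d t (s.1, s.2.1))
        - k₁ / k₂ * ((1 - s.2.2.1 2) / (1 + s.2.2.1 2)) := by
  rw [fderiv_compositeV_closedLoop hV hk₂.ne' hc hs (hu t ht _ _)]
  have h1 := attitudeError_nonneg hs
  have h2 := hκk t ht s hs
  gcongr

theorem isLyapunovFunction_compositeV
    (hV : IsLyapunovFunction (doubleIntegrator u d) {0} univ Vξ) (hk₁ : 0 < k₁) (hk₂ : 0 < k₂)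
    (hc : 0 < c) (hκk : ∀ t : ℝ, 0 ≤ t → ∀ s ∈ setD, k₁ ≤ κ₁ t s)
    (hu : ∀ t : ℝ, 0 ≤ t → ∀ ξ₁ ξ₂ : E3, u (ξ₁, ξ₂, d t) ≠ 0) :
    IsLyapunovFunction (closedLoop u Vξ d k₂ c κ₁ ψ) setA setD (compositeV Vξ k₂) where
  contDiffAt s hs := contDiffAt_compositeV hV.contDiff hk₂.ne' hs
  eq_zero s hs := by
    rw [compositeV_eq, hs.1, hs.2.1, hs.2.2.1, hV.eq_zero (0, 0) rfl]
    simp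
  pos s hs := by
    obtain ⟨hD, hA⟩ := hs
    by_cases h : (s.1, s.2.1) = (0 : E3 × E3)
    · have hz : s.2.2.1 2 < 1 := by
        refine lt_of_le_of_ne (coord_bounds_of_norm_eq_one hD.1).2 fun h1 => hA ?_
        exact ⟨congrArg Prod.fst h, congrArg Prod.snd h, eq_zeta_of_coord hD.1 h1, hD.2.2⟩
      have hz' := one_add_coord_pos_of_mem_setD hD
      rw [compositeV_eq]
      have := hV.nonneg (s.1, s.2.1)
      have : 0 < (1 - s.2.2.1 2) / (1 + s.2.2.1 2) / (2 * k₂) :=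
        div_pos (div_pos (by linarith) hz') (by positivity)
      linarith
    · exact (hV.pos _ ⟨mem_univ _, h⟩).trans_le (le_compositeV hk₂ hD)
  isCompact_sublevel := isCompact_sublevel_compositeV hV hk₂
  deriv_nonpos t ht s hs := by
    refine (closedLoop_deriv_le hV.differentiable hk₂ hc hκk hu ht hs).trans ?_
    have h1 := hV.deriv_nonpos t ht (s.1, s.2.1) (mem_univ _)
    have h2 := mul_nonneg (by positivity : 0 ≤ k₁ / k₂) (attitudeError_nonneg hs)
    linarith

theorem isStrictLyapunovFunction_compositeV
    (hV : IsStrictLyapunovFunction (doubleIntegrator u d) {0} univ Vξ) (hk₁ : 0 < k₁)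
    (hk₂ : 0 < k₂) (hc : 0 < c) (hκk : ∀ t : ℝ, 0 ≤ t → ∀ s ∈ setD, k₁ ≤ κ₁ t s)
    (hu : ∀ t : ℝ, 0 ≤ t → ∀ ξ₁ ξ₂ : E3, u (ξ₁, ξ₂, d t) ≠ 0) :
    IsStrictLyapunovFunction (closedLoop u Vξ d k₂ c κ₁ ψ) setA setD (compositeV Vξ k₂) := by
  obtain ⟨hL, W, hWc, hWpos, hW⟩ := hV
  refine ⟨isLyapunovFunction_compositeV hL hk₁ hk₂ hc hκk hu,
    fun s => max (W (s.1, s.2.1)) 0 + k₁ / k₂ * ((1 - s.2.2.1 2) / (1 + s.2.2.1 2)),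
    ?_, fun s hs => ?_, fun t ht s hs => ?_⟩
  · have hW' : Continuous W := continuousOn_univ.1 hWc
    have hcoord : Continuous fun s : State => s.2.2.1 2 := by fun_prop
    refine ((hW'.comp (by fun_prop : Continuous fun s : State => (s.1, s.2.1))).max
      continuous_const).continuousOn.add (continuousOn_const.mul
        ((continuous_const.sub hcoord).continuousOn.div (continuous_const.add hcoord).continuousOn
          fun s hs => (one_add_coord_pos_of_mem_setD hs).ne'))
  · obtain ⟨hD, hA⟩ := hs
    have h0 := mul_nonneg (by positivity : 0 ≤ k₁ / k₂) (attitudeError_nonneg hD)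
    by_cases h : (s.1, s.2.1) = (0 : E3 × E3)
    · have hz : s.2.2.1 2 < 1 := by
        refine lt_of_le_of_ne (coord_bounds_of_norm_eq_one hD.1).2 fun h1 => hA ?_
        exact ⟨congrArg Prod.fst h, congrArg Prod.snd h, eq_zeta_of_coord hD.1 h1, hD.2.2⟩
      have hz' := one_add_coord_pos_of_mem_setD hD
      have : 0 < k₁ / k₂ * ((1 - s.2.2.1 2) / (1 + s.2.2.1 2)) :=
        mul_pos (by positivity) (div_pos (by linarith) hz')
      have := le_max_right (W (s.1, s.2.1)) 0
      linarith
    · have := (hWpos _ ⟨mem_univ _, h⟩).trans_le (le_max_left (W (s.1, s.2.1)) 0)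
      linarith
  · have h1 := closedLoop_deriv_le (ψ := ψ) hL.differentiable hk₂ hc hκk hu ht hs
    have h2 := hL.deriv_nonpos t ht (s.1, s.2.1) (mem_univ _)
    have h3 := hW t ht (s.1, s.2.1) (mem_univ _)
    have h4 : max (W (s.1, s.2.1)) 0 ≤
        -fderiv ℝ Vξ (s.1, s.2.1) (doubleIntegrator u d t (s.1, s.2.1)) :=
      max_le (by linarith) (by linarith)
    refine h1.trans ?_
    simp only
    linarith

end CompositeIsLyapunov

/-! ### Continuity of the closed loop -/

section Continuity

variable {T : Type*} [TopologicalSpace T] {S : Set T}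

@[fun_prop]
theorem continuousOn_act {A : T → Mat3} {x : T → E3} (hA : ContinuousOn A S)
    (hx : ContinuousOn x S) : ContinuousOn (fun q => act (A q) (x q)) S := by
  have h : ContinuousOn (fun q => actL (A q) (x q)) S :=
    (actL.continuous.comp_continuousOn hA).clm_apply hx
  simpa only [actL_apply] using h

@[fun_prop]
theorem continuousOn_skew {x : T → E3} (hx : ContinuousOn x S) :
    ContinuousOn (fun q => skew (x q)) S := by
  simpa only [skewL_apply] using skewL.continuous.comp_continuousOn' hx

@[fun_prop]
theorem continuousOn_transpose {A : T → Mat3} (hA : ContinuousOn A S) :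
    ContinuousOn (fun q => (A q).transpose) S := by
  simpa only [transposeL_apply] using transposeL.continuous.comp_continuousOn' hA

@[fun_prop]
theorem continuousOn_matrix_mul {A B : T → Mat3} (hA : ContinuousOn A S)
    (hB : ContinuousOn B S) : ContinuousOn (fun q => A q * B q) S := by
  have h : ContinuousOn (fun q => mulL (A q) (B q)) S :=
    (mulL.continuous.comp_continuousOn hA).clm_apply hB
  simpa only [mulL_apply] using h

variable {u : E3 × E3 × E3 → E3} {Vξ : E3 × E3 → ℝ} {d : ℝ → E3} {k₂ c : ℝ}
  {κ₁ ψ : ℝ → State → ℝ}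

theorem continuous_gradient_snd (hV : ContDiff ℝ 1 Vξ) :
    Continuous fun s : State => gradient (fun y => Vξ (s.1, y)) s.2.1 := by
  have h : ∀ s : State, fderiv ℝ (fun y => Vξ (s.1, y)) s.2.1 =
      (fderiv ℝ Vξ (s.1, s.2.1)).comp (ContinuousLinearMap.inr ℝ E3 E3) := fun s =>
    (((hV.differentiable one_ne_zero) (s.1, s.2.1)).hasFDerivAt.comp s.2.1
      (hasFDerivAt_prodMk_right s.1 s.2.1)).fderiv
  simp only [gradient, h]
  refine (InnerProductSpace.toDual ℝ E3).symm.continuous.comp ?_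
  have := hV.continuous_fderiv one_ne_zero
  exact ((this.comp (by fun_prop : Continuous fun s : State => (s.1, s.2.1)))).clm_comp
    continuous_const

/-- The data of the closed loop that are continuous on `[0, ∞) × 𝒟`: the acceleration, the angular
velocity, and the angular velocity relative to the desired one. -/
theorem continuousOn_closedLoop_terms (hu : ContDiff ℝ 1 u) (hV : ContDiff ℝ 1 Vξ)
    (hd : ContDiff ℝ 1 d) (hc : 0 < c)
    (hu0 : ∀ t : ℝ, 0 ≤ t → ∀ ξ₁ ξ₂ : E3, u (ξ₁, ξ₂, d t) ≠ 0)
    (hκ : ContinuousOn (fun q : ℝ × State => κ₁ q.1 q.2) (Ici 0 ×ˢ setD))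
    (hψ : ContinuousOn (fun q : ℝ × State => ψ q.1 q.2) (Ici 0 ×ˢ setD)) :
    ContinuousOn (fun q : ℝ × State => x2Dot (virtualControl u d q.1 q.2) (d q.1)
      (thrust u d q.1 q.2) q.2.2.2.1 q.2.2.2.2) (Ici 0 ×ˢ setD) ∧
    ContinuousOn (fun q : ℝ × State => angularVelocity u Vξ d k₂ c κ₁ ψ q.1 q.2)
      (Ici 0 ×ˢ setD) ∧
    ContinuousOn (fun q : ℝ × State => act q.2.2.2.2
      (omegaV (virtualControl u d q.1 q.2) (virtualControlDot u d q.1 q.2)))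
      (Ici 0 ×ˢ setD) := by
  have hdc := hd.continuous
  have huc := hu.continuous
  have hd' : Continuous (deriv d) := hd.continuous_deriv le_rfl
  have hu' := hu.continuous_fderiv one_ne_zero
  set S : Set (ℝ × State) := Ici 0 ×ˢ setD with hS
  have hv : ContinuousOn (fun q : ℝ × State => virtualControl u d q.1 q.2) S := by
    unfold virtualControl
    fun_prop
  have hv0 : ∀ q ∈ S, ‖virtualControl u d q.1 q.2‖ ≠ 0 := fun q hq =>
    norm_ne_zero_iff.2 (hu0 _ hq.1 _ _)
  have hf : ContinuousOn (fun q : ℝ × State => thrust u d q.1 q.2) S := hv.norm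
  have hx2 : ContinuousOn (fun q : ℝ × State => x2Dot (virtualControl u d q.1 q.2) (d q.1)
      (thrust u d q.1 q.2) q.2.2.2.1 q.2.2.2.2) S := by
    unfold x2Dot
    have := hf.div hv.norm hv0
    fun_prop
  have hdv : ContinuousOn (fun q : ℝ × State => virtualControlDot u d q.1 q.2) S := by
    unfold virtualControlDot
    refine ContinuousOn.clm_apply
      (hu'.comp_continuousOn (f := fun q : ℝ × State => (q.2.1, q.2.2.1, d q.1)) (by fun_prop)) ?_
    have : ContinuousOn (fun q : ℝ × State => deriv d q.1) S := by fun_prop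
    have h2 : ContinuousOn (fun q : ℝ × State => q.2.2.1) S := by fun_prop
    exact h2.prodMk (hx2.prodMk this)
  have hom : ContinuousOn (fun q : ℝ × State => act q.2.2.2.2
      (omegaV (virtualControl u d q.1 q.2) (virtualControlDot u d q.1 q.2))) S := by
    unfold omegaV
    have : ContinuousOn (fun q : ℝ × State => (‖virtualControl u d q.1 q.2‖ ^ 2)⁻¹) S :=
      (hv.norm.pow 2).inv₀ fun q hq => pow_ne_zero 2 (hv0 q hq)
    fun_prop
  have hlam : ContinuousOn (fun q : ℝ × State =>
      lambdaTerm Vξ (virtualControl u d q.1 q.2) q.2) S := by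
    unfold lambdaTerm
    have := ((continuous_gradient_snd hV).comp continuous_snd).continuousOn (s := S)
    have hR : ContinuousOn (fun q : ℝ × State => q.2.2.2.2) S := by fun_prop
    exact hv.norm.smul (continuousOn_act hR this)
  have hx3 : ContinuousOn (fun q : ℝ × State => q.2.2.2.1) S := by fun_prop
  have hΔ : ∀ q ∈ S, 1 - inner ℝ zeta q.2.2.2.1 + c ≠ 0 := fun q hq => by
    rw [inner_zeta]
    linarith [(coord_bounds_of_norm_eq_one hq.2.1).2]
  have hbeta : ContinuousOn (fun q : ℝ × State => betaTerm k₂ c q.2.2.2.1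
      (lambdaTerm Vξ (virtualControl u d q.1 q.2) q.2)) S := by
    unfold betaTerm
    have hz : ContinuousOn (fun q : ℝ × State => (inner ℝ zeta q.2.2.2.1 : ℝ)) S :=
      continuousOn_const.inner hx3
    have hden : ContinuousOn (fun q : ℝ × State => 1 - inner ℝ zeta q.2.2.2.1 + c) S := by fun_prop
    have h1 : ContinuousOn
        (fun q : ℝ × State => k₂ * (1 + inner ℝ zeta q.2.2.2.1)) S := by fun_prop
    have hproj := continuousOn_act (continuousOn_const (c := proj) (s := S)) hlam
    refine ((h1.mul (continuousOn_const.inner hlam)).smul hx3).sub ?_ |>.sub ?_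
    · refine ContinuousOn.smul (ContinuousOn.div ?_ hden hΔ) hlam
      fun_prop
    · exact ContinuousOn.smul (ContinuousOn.div (h1.mul (hx3.inner hproj)) hden hΔ) hx3
  refine ⟨hx2, ?_, hom⟩
  unfold angularVelocity
  fun_prop

theorem continuousOn_closedLoop (hu : ContDiff ℝ 1 u) (hV : ContDiff ℝ 1 Vξ)
    (hd : ContDiff ℝ 1 d) (hc : 0 < c)
    (hu0 : ∀ t : ℝ, 0 ≤ t → ∀ ξ₁ ξ₂ : E3, u (ξ₁, ξ₂, d t) ≠ 0)
    (hκ : ContinuousOn (fun q : ℝ × State => κ₁ q.1 q.2) (Ici 0 ×ˢ setD))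
    (hψ : ContinuousOn (fun q : ℝ × State => ψ q.1 q.2) (Ici 0 ×ˢ setD)) :
    ContinuousOn (fun q : ℝ × State => closedLoop u Vξ d k₂ c κ₁ ψ q.1 q.2)
      (Ici 0 ×ˢ setD) := by
  obtain ⟨h1, h2, h3⟩ := continuousOn_closedLoop_terms (k₂ := k₂) hu hV hd hc hu0 hκ hψ
  unfold closedLoop errorDynamics
  have hx2 : ContinuousOn (fun q : ℝ × State => q.2.2.1) (Ici 0 ×ˢ setD) := by fun_prop
  have hx3 : ContinuousOn (fun q : ℝ × State => q.2.2.2.1) (Ici 0 ×ˢ setD) := by fun_prop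
  have hR : ContinuousOn (fun q : ℝ × State => q.2.2.2.2) (Ici 0 ×ˢ setD) := by fun_prop
  exact hx2.prodMk (h1.prodMk ((continuousOn_act (continuousOn_skew hx3) (h2.sub h3)).prodMk
    (continuousOn_matrix_mul (continuousOn_skew h2) hR).neg))

end Continuity

/-! ### Tangent extensions of the right-hand sides -/

section Extension

/-- Tietze's theorem for bounded maps into a finite-dimensional space. -/
theorem exists_bounded_continuous_extension {Z E : Type*} [MetricSpace Z]
    [NormedAddCommGroup E] [NormedSpace ℝ E] [FiniteDimensional ℝ E] {K : Set Z}
    (hK : IsCompact K) {f : Z → E} (hf : ContinuousOn f K) :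
    ∃ g : Z → E, Continuous g ∧ (∃ C, ∀ z, ‖g z‖ ≤ C) ∧ EqOn g f K := by
  obtain ⟨C, hC⟩ := hK.exists_bound_of_continuousOn hf
  have : TietzeExtension (Metric.closedBall (0 : E) (max C 1)) :=
    Metric.instTietzeExtensionClosedBall ℝ 0 (by positivity)
  obtain ⟨g, hg1, hg2⟩ := ContinuousMap.exists_forall_mem_restrict_eq hK.isClosed
    ⟨K.domRestrict f, hf.domRestrict⟩ (t := Metric.closedBall 0 (max C 1)) fun x =>
      mem_closedBall_zero_iff.2 ((hC x x.2).trans (le_max_left _ _))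
  refine ⟨g, g.continuous, ⟨max C 1, fun z => by simpa using hg1 z⟩, fun z hz => ?_⟩
  exact congrArg (fun h : C(K, E) => h ⟨z, hz⟩) hg2

/-- The radial retraction of a normed space, onto the ball of radius `r` about `0`. -/
noncomputable def radialRetraction {E : Type*} [NormedAddCommGroup E] [NormedSpace ℝ E] (r : ℝ)
    (x : E) : E := (r / max r ‖x‖) • x

variable {E : Type*} [NormedAddCommGroup E] [NormedSpace ℝ E] {r : ℝ}

theorem continuous_radialRetraction (hr : 0 < r) :
    Continuous (radialRetraction r : E → E) :=
  (continuous_const.div (continuous_const.max continuous_norm)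
    fun _ => (hr.trans_le (le_max_left _ _)).ne').smul continuous_id

theorem norm_radialRetraction_le (hr : 0 < r) (x : E) : ‖radialRetraction r x‖ ≤ r := by
  have h := hr.trans_le (le_max_left r ‖x‖)
  rw [radialRetraction, norm_smul, Real.norm_of_nonneg (by positivity), div_mul_eq_mul_div,
    div_le_iff₀ h]
  gcongr
  exact le_max_right _ _

theorem radialRetraction_eq (hr : 0 < r) {x : E} (hx : ‖x‖ ≤ r) : radialRetraction r x = x := by
  rw [radialRetraction, max_eq_left hx, div_self hr.ne', one_smul]

end Extension

section TangentExtension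

variable {u : E3 × E3 × E3 → E3} {Vξ : E3 × E3 → ℝ} {d : ℝ → E3} {k₂ c : ℝ}
  {κ₁ ψ : ℝ → State → ℝ}

theorem hasTangentExtension_univ {X : Type*} [NormedAddCommGroup X] [NormedSpace ℝ X]
    [FiniteDimensional ℝ X] {F : ℝ → X → X} {D K : Set X}
    (hF : ContinuousOn (fun q : ℝ × X => F q.1 q.2) (Ici 0 ×ˢ D)) {a : ℝ} (ha : 0 ≤ a) (b : ℝ)
    (hK : IsCompact K) (hKD : K ⊆ D) : HasTangentExtension F univ K a b := by
  obtain ⟨g, hgc, ⟨C, hC⟩, hg⟩ := exists_bounded_continuous_extension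
    ((isCompact_Icc (a := a) (b := b)).prod hK)
    (hF.mono (prod_mono (fun t ht => ha.trans ht.1) hKD))
  exact ⟨fun t x => g (t, x), hgc, ⟨C, fun t x => hC _⟩, fun t ht x hx => hg ⟨ht, hx⟩,
    fun s _ _ t _ => mem_univ _⟩

theorem act_skew_smul_left (r : ℝ) (x e : E3) : act (skew (r • x)) e = act (skew x) (r • e) := by
  refine E3_ext ?_ ?_ ?_ <;> simp <;> ring

theorem skew_mul_smul (r : ℝ) (w : E3) (R : Mat3) : skew w * (r • R) = skew (r • w) * R := by
  rw [← skewL_apply (r • w), map_smul, Matrix.mul_smul, Matrix.smul_mul]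
  rfl

/-- Only the angular velocities and the linear accelerations are extended; the kinematic form of
the attitude equations, which keeps the sphere and the rotation group invariant, is retained. -/
theorem hasTangentExtension_closedLoop (hu : ContDiff ℝ 1 u) (hV : ContDiff ℝ 1 Vξ)
    (hd : ContDiff ℝ 1 d) (hc : 0 < c)
    (hu0 : ∀ t : ℝ, 0 ≤ t → ∀ ξ₁ ξ₂ : E3, u (ξ₁, ξ₂, d t) ≠ 0)
    (hκ : ContinuousOn (fun q : ℝ × State => κ₁ q.1 q.2) (Ici 0 ×ˢ setD))
    (hψ : ContinuousOn (fun q : ℝ × State => ψ q.1 q.2) (Ici 0 ×ˢ setD))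
    {a : ℝ} (ha : 0 ≤ a) (b : ℝ) {K : Set State} (hK : IsCompact K) (hKD : K ⊆ setD) :
    HasTangentExtension (closedLoop u Vξ d k₂ c κ₁ ψ) stateSpace K a b := by
  obtain ⟨h1, h2, h3⟩ := continuousOn_closedLoop_terms (k₂ := k₂) hu hV hd hc hu0 hκ hψ
  have hx2 : ContinuousOn (fun q : ℝ × State => q.2.2.1) (Ici 0 ×ˢ setD) := by fun_prop
  obtain ⟨g, hgc, ⟨C, hC⟩, hg⟩ := exists_bounded_continuous_extension
    ((isCompact_Icc (a := a) (b := b)).prod hK)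
    ((hx2.prodMk (h1.prodMk ((h2.sub h3).prodMk h2))).mono
      (prod_mono (fun t ht => ha.trans ht.1) hKD))
  -- the closed loop, as a function of the extended data, of `x₃` and of `R`
  let Γ : (E3 × E3 × E3 × E3) × E3 × Mat3 → State := fun p =>
    (p.1.1, p.1.2.1, act (skew p.2.1) p.1.2.2.1, -(skew p.1.2.2.2 * p.2.2))
  have hΓ : Continuous Γ := by
    rw [← continuousOn_univ]
    have e1 : ContinuousOn (fun p : (E3 × E3 × E3 × E3) × E3 × Mat3 => act (skew p.2.1) p.1.2.2.1)
        univ := by fun_prop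
    have e2 : ContinuousOn (fun p : (E3 × E3 × E3 × E3) × E3 × Mat3 => skew p.1.2.2.2 * p.2.2)
        univ := continuousOn_matrix_mul (by fun_prop) (by fun_prop)
    have e3 : ContinuousOn (fun p : (E3 × E3 × E3 × E3) × E3 × Mat3 => p.1.1) univ := by fun_prop
    have e4 : ContinuousOn (fun p : (E3 × E3 × E3 × E3) × E3 × Mat3 => p.1.2.1) univ := by fun_prop
    exact e3.prodMk (e4.prodMk (e1.prodMk e2.neg))
  let P : ℝ × State → (E3 × E3 × E3 × E3) × E3 × Mat3 := fun q =>
    (g q, radialRetraction 2 q.2.2.2.1, radialRetraction 2 q.2.2.2.2)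
  have hP : Continuous P := hgc.prodMk
    (((continuous_radialRetraction two_pos).comp (by fun_prop)).prodMk
      ((continuous_radialRetraction two_pos).comp (by fun_prop)))
  have hPC : ∀ q, P q ∈ Metric.closedBall (0 : E3 × E3 × E3 × E3) C ×ˢ
      Metric.closedBall (0 : E3) 2 ×ˢ Metric.closedBall (0 : Mat3) 2 := fun q =>
    ⟨mem_closedBall_zero_iff.2 (hC q),
      mem_closedBall_zero_iff.2 (norm_radialRetraction_le two_pos _),
      mem_closedBall_zero_iff.2 (norm_radialRetraction_le two_pos _)⟩
  obtain ⟨B, hB⟩ := ((isCompact_closedBall (0 : E3 × E3 × E3 × E3) C).prod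
    ((isCompact_closedBall (0 : E3) 2).prod
      (isCompact_closedBall (0 : Mat3) 2))).exists_bound_of_continuousOn hΓ.continuousOn
  refine ⟨fun t s => Γ (P (t, s)), hΓ.comp hP, ⟨B, fun t s => hB _ (hPC _)⟩, ?_, ?_⟩
  · intro t ht s hs
    have hsD := hKD hs
    have e1 : radialRetraction 2 s.2.2.1 = s.2.2.1 :=
      radialRetraction_eq two_pos (by rw [hsD.1]; norm_num)
    have e2 : radialRetraction 2 s.2.2.2 = s.2.2.2 := by
      refine radialRetraction_eq two_pos ?_
      rw [norm_of_mem_SO3 hsD.2.2, Real.sqrt_le_left (by norm_num)]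
      norm_num
    simp only [Γ, P, hg (show (t, s) ∈ Icc a b ×ˢ K from ⟨ht, hs⟩), e1, e2]
    rfl
  · intro s hs h0 t ht
    have hd1 : ∀ r ∈ Icc a b, HasDerivWithinAt (fun r => (s r).2.2.1) (act (skew (s r).2.2.1)
        ((2 / max 2 ‖(s r).2.2.1‖) • (g (r, s r)).2.2.1)) (Icc a b) r := fun r hr => by
      rw [← act_skew_smul_left]
      exact ((ContinuousLinearMap.fst ℝ E3 Mat3).comp ((ContinuousLinearMap.snd ℝ E3
        (E3 × Mat3)).comp (ContinuousLinearMap.snd ℝ E3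
          (E3 × E3 × Mat3)))).hasFDerivAt.comp_hasDerivWithinAt r (hs r hr)
    have hd2 : ∀ r ∈ Icc a b, HasDerivWithinAt (fun r => (s r).2.2.2)
        (-(skew ((2 / max 2 ‖(s r).2.2.2‖) • (g (r, s r)).2.2.2) * (s r).2.2.2)) (Icc a b) r :=
      fun r hr => by
        rw [← skew_mul_smul]
        exact ((ContinuousLinearMap.snd ℝ E3 Mat3).comp ((ContinuousLinearMap.snd ℝ E3
          (E3 × Mat3)).comp (ContinuousLinearMap.snd ℝ E3
            (E3 × E3 × Mat3)))).hasFDerivAt.comp_hasDerivWithinAt r (hs r hr)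
    exact ⟨(norm_eq_of_hasDerivWithinAt_skew hd1 t ht).trans h0.1,
      mem_SO3_of_hasDerivWithinAt hd2 h0.2 t ht⟩

theorem continuous_doubleIntegrator (hu : Continuous u) (hd : Continuous d) :
    Continuous fun q : ℝ × (E3 × E3) => doubleIntegrator u d q.1 q.2 := by
  unfold doubleIntegrator
  fun_prop

end TangentExtension

/-! ### Preservation of the thrust direction -/

section ThrustDirection

/-- The direction of a moving vector `v` rotates with the angular velocity `ω_v`. -/
theorem hasDerivWithinAt_direction {v : ℝ → E3} {dv : E3} {J : Set ℝ} {t : ℝ}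
    (hv : HasDerivWithinAt v dv J t) (h0 : v t ≠ 0) :
    HasDerivWithinAt (fun r => ‖v r‖⁻¹ • v r)
      (act (skew (omegaV (v t) dv)) (‖v t‖⁻¹ • v t)) J t := by
  have hn : ‖v t‖ ≠ 0 := norm_ne_zero_iff.2 h0
  have h1 : HasDerivWithinAt (fun r => ‖v r‖) (inner ℝ (v t) dv / ‖v t‖) J t := by
    have := (hv.norm_sq).sqrt (pow_ne_zero 2 hn)
    simp only [Real.sqrt_sq (norm_nonneg _)] at this
    refine this.congr_deriv ?_
    field_simp
  refine ((h1.inv hn).smul hv).congr_deriv ?_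
  have hS := norm_sq_eq (v t)
  have hm : ‖v t‖⁻¹ * ‖v t‖ = 1 := inv_mul_cancel₀ hn
  rw [omegaV, inner_eq, div_eq_mul_inv, div_eq_mul_inv, ← inv_pow]
  simp only [Pi.inv_apply]
  set m := ‖v t‖⁻¹
  set N := ‖v t‖
  have hmS : m ^ 2 * (v t 0 ^ 2 + v t 1 ^ 2 + v t 2 ^ 2) = 1 := by
    rw [← hS, ← mul_pow, hm, one_pow]
  refine E3_ext ?_ ?_ ?_ <;> simp
  · linear_combination -(m * dv 0) * hmS
  · linear_combination -(m * dv 1) * hmS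
  · linear_combination -(m * dv 2) * hmS

variable {u : E3 × E3 × E3 → E3} {Vξ : E3 × E3 → ℝ} {d : ℝ → E3} {k₂ c : ℝ}
  {κ₁ ψ : ℝ → State → ℝ}

theorem hasDerivWithinAt_virtualControl (hu : ContDiff ℝ 1 u) (hd : ContDiff ℝ 1 d)
    {s : ℝ → State} {J : Set ℝ} {t : ℝ}
    (hs : HasDerivWithinAt s (closedLoop u Vξ d k₂ c κ₁ ψ t (s t)) J t) :
    HasDerivWithinAt (fun r => virtualControl u d r (s r)) (virtualControlDot u d t (s t)) J t := by
  have h1 := (ContinuousLinearMap.fst ℝ E3 (E3 × E3 × Mat3)).hasFDerivAt.comp_hasDerivWithinAt t hs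
  have h2 := ((ContinuousLinearMap.fst ℝ E3 (E3 × Mat3)).comp
    (ContinuousLinearMap.snd ℝ E3 (E3 × E3 × Mat3))).hasFDerivAt.comp_hasDerivWithinAt t hs
  have h3 := ((hd.differentiable one_ne_zero) t).hasDerivAt.hasDerivWithinAt (s := J)
  exact ((hu.differentiable one_ne_zero) _).hasFDerivAt.comp_hasDerivWithinAt
    (f := fun r => ((s r).1, (s r).2.1, d r)) t (h1.prodMk (h2.prodMk h3))

/-- Both `x₃` and `R v / ‖v‖` solve the linear equation `ẏ = [y]ₓ (ω - R ω_v)`, so that the norm of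
their difference is constant. -/
theorem thrustConstraint_of_isSolution (hu : ContDiff ℝ 1 u) (hd : ContDiff ℝ 1 d)
    (hu0 : ∀ t : ℝ, 0 ≤ t → ∀ ξ₁ ξ₂ : E3, u (ξ₁, ξ₂, d t) ≠ 0) {t₀ T : ℝ} (ht₀ : 0 ≤ t₀)
    (hT : t₀ ≤ T) {s : ℝ → State}
    (hs : IsSolution (closedLoop u Vξ d k₂ c κ₁ ψ) stateSpace (Icc t₀ T) s)
    (h0 : s t₀ ∈ thrustConstraint u d t₀) : s T ∈ thrustConstraint u d T := by
  set v : ℝ → E3 := fun t => virtualControl u d t (s t) with hv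
  set y : ℝ → E3 := fun t => act (s t).2.2.2 (‖v t‖⁻¹ • v t) with hy
  set e : ℝ → E3 := fun t => angularVelocity u Vξ d k₂ c κ₁ ψ t (s t)
    - act (s t).2.2.2 (omegaV (v t) (virtualControlDot u d t (s t))) with he
  have hx : ∀ t ∈ Icc t₀ T, HasDerivWithinAt (fun t => (s t).2.2.1 - y t)
      (act (skew ((s t).2.2.1 - y t)) (e t)) (Icc t₀ T) t := by
    intro t ht
    obtain ⟨hM, hst⟩ := hs t ht
    have hx3 : HasDerivWithinAt (fun t => (s t).2.2.1) (act (skew (s t).2.2.1) (e t))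
        (Icc t₀ T) t :=
      ((ContinuousLinearMap.fst ℝ E3 Mat3).comp ((ContinuousLinearMap.snd ℝ E3
        (E3 × Mat3)).comp (ContinuousLinearMap.snd ℝ E3
          (E3 × E3 × Mat3)))).hasFDerivAt.comp_hasDerivWithinAt t hst
    have hR : HasDerivWithinAt (fun t => (s t).2.2.2)
        (-(skew (angularVelocity u Vξ d k₂ c κ₁ ψ t (s t)) * (s t).2.2.2)) (Icc t₀ T) t :=
      ((ContinuousLinearMap.snd ℝ E3 Mat3).comp ((ContinuousLinearMap.snd ℝ E3
        (E3 × Mat3)).comp (ContinuousLinearMap.snd ℝ E3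
          (E3 × E3 × Mat3)))).hasFDerivAt.comp_hasDerivWithinAt t hst
    have hn := hasDerivWithinAt_direction (hasDerivWithinAt_virtualControl hu hd hst)
      (hu0 t (ht₀.trans ht.1) _ _)
    have hyd := (actL.hasFDerivAt.comp_hasDerivWithinAt t hR).clm_apply hn
    refine (hx3.sub hyd).congr_deriv ?_
    have hRS := hM.2
    have e1 : ∀ (w n : E3) (R : Mat3), act (-(skew w * R)) n = -act (skew w) (act R n) := by
      intro w n R
      refine E3_ext ?_ ?_ ?_ <;> simp only [act_apply, neg_skew_mul_apply, PiLp.neg_apply] <;>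
        simp [skew] <;> ring
    change act (skew (s t).2.2.1) (e t) - (actL _ _ + actL _ _) = _
    simp only [actL_apply]
    rw [e1, act_act_skew_of_mem_SO3 hRS]
    change _ - (-act (skew _) (y t) + act (skew _) (y t)) = _
    simp only [he]
    refine E3_ext ?_ ?_ ?_ <;> simp <;> ring
  have hnorm := norm_eq_of_hasDerivWithinAt_skew hx T ⟨hT, le_rfl⟩
  have h0' : (s t₀).2.2.1 - y t₀ = 0 := sub_eq_zero.2 h0
  simp only [h0', norm_zero, norm_eq_zero] at hnorm
  exact sub_eq_zero.1 hnorm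

end ThrustDirection

/-! ### Comparison with the unperturbed double integrator -/

section Comparison

variable {u : E3 × E3 × E3 → E3} {Vξ : E3 × E3 → ℝ} {d : ℝ → E3} {k₁ k₂ c : ℝ}
  {κ₁ ψ : ℝ → State → ℝ}

theorem le_mul_exp_of_hasDerivWithinAt_le {E E' : ℝ → ℝ} {a b κ : ℝ}
    (hE : ∀ t ∈ Icc a b, HasDerivWithinAt E (E' t) (Icc a b) t)
    (hle : ∀ t ∈ Icc a b, E' t ≤ κ * E t) :
    ∀ t ∈ Icc a b, E t ≤ E a * Real.exp (κ * (t - a)) := by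
  intro t ht
  have hd : ∀ r ∈ Icc a b, HasDerivWithinAt (fun r => E r * Real.exp (-(κ * (r - a))))
      ((E' r - κ * E r) * Real.exp (-(κ * (r - a)))) (Icc a b) r := fun r hr => by
    have h1 : HasDerivAt (fun r => Real.exp (-(κ * (r - a))))
        (Real.exp (-(κ * (r - a))) * -(κ * 1)) r :=
      ((((hasDerivAt_id r).sub_const a).const_mul κ).neg).exp
    refine ((hE r hr).mul h1.hasDerivWithinAt).congr_deriv ?_
    ring
  have hanti := antitoneOn_of_hasDerivWithinAt_nonpos (convex_Icc a b)
    (fun r hr => (hd r hr).continuousWithinAt)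
    (fun r hr => (hd r (interior_subset hr)).mono interior_subset) fun r hr =>
      mul_nonpos_of_nonpos_of_nonneg (by linarith [hle r (interior_subset hr)])
        (Real.exp_pos _).le
  have h := hanti ⟨le_rfl, ht.1.trans ht.2⟩ ht ht.1
  simp only [sub_self, mul_zero, neg_zero, Real.exp_zero, mul_one] at h
  rwa [Real.exp_neg, ← div_eq_mul_inv, div_le_iff₀ (Real.exp_pos _)] at h

theorem exists_doubleIntegrator_solution
    (hV : IsLyapunovFunction (doubleIntegrator u d) {0} univ Vξ)
    (hu : Continuous u) (hd : Continuous d) {a : ℝ} (ha : 0 ≤ a) (b : ℝ) (ξ₀ : E3 × E3) :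
    ∃ y, IsSolution (doubleIntegrator u d) univ (Icc a b) y ∧ y a = ξ₀ :=
  exists_isSolution_Icc hV isOpen_univ (by simp) ha (mem_univ _)
    (hasTangentExtension_univ (D := univ) (continuous_doubleIntegrator hu hd).continuousOn ha b
      (hV.isCompact_sublevel _) (subset_univ _))

/-- On bounded sets of states the control law is bounded and Lipschitz, uniformly in time. -/
theorem exists_lipschitz_bound (hu : ContDiff ℝ 1 u) {B : ℝ} (hB : ∀ t, 0 ≤ t → ‖d t‖ ≤ B)
    (r : ℝ) : ∃ L C : ℝ, 0 ≤ C ∧ ∀ t, 0 ≤ t → ∀ ξ ∈ Metric.closedBall (0 : E3 × E3) r,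
      ‖u (ξ.1, ξ.2, d t)‖ ≤ C ∧ ∀ η ∈ Metric.closedBall (0 : E3 × E3) r,
        ‖u (ξ.1, ξ.2, d t) - u (η.1, η.2, d t)‖ ≤ L * ‖ξ - η‖ := by
  have hK := isCompact_closedBall (0 : E3 × E3 × E3) (max r B)
  obtain ⟨C, hC⟩ := hK.exists_bound_of_continuousOn hu.continuous.continuousOn
  obtain ⟨L, hL⟩ := hK.exists_bound_of_continuousOn
    (hu.continuous_fderiv one_ne_zero).continuousOn
  have hmem : ∀ t, 0 ≤ t → ∀ ξ ∈ Metric.closedBall (0 : E3 × E3) r,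
      (ξ.1, ξ.2, d t) ∈ Metric.closedBall (0 : E3 × E3 × E3) (max r B) := fun t ht ξ hξ => by
    rw [mem_closedBall_zero_iff] at hξ ⊢
    refine max_le ?_ (max_le ?_ ?_)
    · exact ((norm_fst_le ξ).trans hξ).trans (le_max_left _ _)
    · exact ((norm_snd_le ξ).trans hξ).trans (le_max_left _ _)
    · exact (hB t ht).trans (le_max_right _ _)
  refine ⟨L, max C 0, le_max_right _ _, fun t ht ξ hξ =>
    ⟨(hC _ (hmem t ht ξ hξ)).trans (le_max_left _ _), fun η hη => ?_⟩⟩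
  refine ((convex_closedBall (0 : E3 × E3 × E3) (max r B)).norm_image_sub_le_of_norm_fderiv_le
    (fun x _ => (hu.differentiable one_ne_zero) x) hL (hmem t ht η hη) (hmem t ht ξ hξ)).trans ?_
  have : ‖((ξ.1, ξ.2, d t) : E3 × E3 × E3) - (η.1, η.2, d t)‖ = ‖ξ - η‖ := by
    simp [Prod.norm_def]
  rw [this]

/-- The coupling term `p = ‖u‖ Rᵀ (ζ - x₃)` is controlled by the attitude part of the composite
function. -/
theorem norm_coupling_sq_le {s : State} (hs : s ∈ setD) {f C : ℝ} (hf : 0 ≤ f) (hC : f ≤ C) :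
    ‖f • act s.2.2.2.transpose (zeta - s.2.2.1)‖ ^ 2 ≤
      4 * C ^ 2 * ((1 - s.2.2.1 2) / (1 + s.2.2.1 2)) := by
  have hz := one_add_coord_pos_of_mem_setD hs
  have hz1 := (coord_bounds_of_norm_eq_one hs.1).2
  rw [norm_smul, norm_act_of_mem_SO3 (transpose_mem_SO3 hs.2.2), mul_pow, norm_zeta_sub_sq hs.1,
    Real.norm_of_nonneg hf]
  have h1 : 1 - s.2.2.1 2 ≤ 2 * ((1 - s.2.2.1 2) / (1 + s.2.2.1 2)) := by
    rw [mul_div_assoc', le_div_iff₀ hz]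
    nlinarith
  have h2 : f ^ 2 ≤ C ^ 2 := by gcongr
  have h3 := attitudeError_nonneg hs
  calc f ^ 2 * (2 * (1 - s.2.2.1 2)) ≤ C ^ 2 * (2 * (1 - s.2.2.1 2)) := by
        gcongr
    _ ≤ C ^ 2 * (2 * (2 * ((1 - s.2.2.1 2) / (1 + s.2.2.1 2)))) := by gcongr
    _ = _ := by ring

/-- Over a time interval on which the composite function hardly decreases, the translational
subsystem stays close to the solution of the double integrator with the same initial state:
the squared distance plus a multiple of the composite function satisfies a Grönwall inequality. -/
theorem norm_sub_sq_le_of_isSolution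
    (hV : IsLyapunovFunction (doubleIntegrator u d) {0} univ Vξ) (hk₁ : 0 < k₁)
    (hk₂ : 0 < k₂) (hc : 0 < c) (hκk : ∀ t : ℝ, 0 ≤ t → ∀ s ∈ setD, k₁ ≤ κ₁ t s)
    (hu0 : ∀ t : ℝ, 0 ≤ t → ∀ ξ₁ ξ₂ : E3, u (ξ₁, ξ₂, d t) ≠ 0)
    {r L C : ℝ}
    (hC : ∀ t, 0 ≤ t → ∀ ξ ∈ Metric.closedBall (0 : E3 × E3) r,
      ‖u (ξ.1, ξ.2, d t)‖ ≤ C ∧ ∀ η ∈ Metric.closedBall (0 : E3 × E3) r,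
        ‖u (ξ.1, ξ.2, d t) - u (η.1, η.2, d t)‖ ≤ L * ‖ξ - η‖)
    {a b : ℝ} (ha : 0 ≤ a) {s : ℝ → State} {y : ℝ → E3 × E3}
    (hs : IsSolution (closedLoop u Vξ d k₂ c κ₁ ψ) stateSpace (Icc a b) s)
    (hsD : ∀ t ∈ Icc a b, s t ∈ setD)
    (hsr : ∀ t ∈ Icc a b, ((s t).1, (s t).2.1) ∈ Metric.closedBall (0 : E3 × E3) r)
    (hy : IsSolution (doubleIntegrator u d) univ (Icc a b) y)
    (hyr : ∀ t ∈ Icc a b, y t ∈ Metric.closedBall (0 : E3 × E3) r)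
    (h0 : y a = ((s a).1, (s a).2.1)) :
    ∀ t ∈ Icc a b, ‖((s t).1, (s t).2.1) - y t‖ ^ 2 ≤
      4 * C ^ 2 * k₂ / k₁ * (compositeV Vξ k₂ (s a) - compositeV Vξ k₂ (s b)) *
        Real.exp ((3 + L ^ 2) * (t - a)) := by
  have hVc := isLyapunovFunction_compositeV (ψ := ψ) hV hk₁ hk₂ hc hκk hu0
  have hanti := hVc.antitoneOn ha hsD fun t ht => (hs t ht).2
  set Q := 4 * C ^ 2 * k₂ / k₁ with hQ
  have hQ0 : 0 ≤ Q := by positivity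
  set A : ℝ → E3 := fun t => (s t).1 - (y t).1 with hA
  set B : ℝ → E3 := fun t => (s t).2.1 - (y t).2 with hB
  set p : ℝ → E3 := fun t =>
    thrust u d t (s t) • act (s t).2.2.2.transpose (zeta - (s t).2.2.1) with hp
  set Δ : ℝ → E3 := fun t => u ((s t).1, (s t).2.1, d t) - u ((y t).1, (y t).2, d t) with hΔ
  have hsq : ∀ t, ‖((s t).1, (s t).2.1) - y t‖ ^ 2 ≤ ‖A t‖ ^ 2 + ‖B t‖ ^ 2 := fun t => by
    rw [Prod.norm_def]
    rcases max_choice ‖A t‖ ‖B t‖ with h | h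
    · change (max ‖A t‖ ‖B t‖) ^ 2 ≤ _
      rw [h]
      linarith [sq_nonneg ‖B t‖]
    · change (max ‖A t‖ ‖B t‖) ^ 2 ≤ _
      rw [h]
      linarith [sq_nonneg ‖A t‖]
  have hAd : ∀ t ∈ Icc a b, HasDerivWithinAt A (B t) (Icc a b) t := fun t ht =>
    ((ContinuousLinearMap.fst ℝ E3 (E3 × E3 × Mat3)).hasFDerivAt.comp_hasDerivWithinAt t
      (hs t ht).2).sub ((ContinuousLinearMap.fst ℝ E3 E3).hasFDerivAt.comp_hasDerivWithinAt t
        (hy t ht).2)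
  have hBd : ∀ t ∈ Icc a b, HasDerivWithinAt B (Δ t + p t) (Icc a b) t := fun t ht => by
    have h1 := ((ContinuousLinearMap.fst ℝ E3 (E3 × Mat3)).comp
      (ContinuousLinearMap.snd ℝ E3 (E3 × E3 × Mat3))).hasFDerivAt.comp_hasDerivWithinAt t
        (hs t ht).2
    have h2 := (ContinuousLinearMap.snd ℝ E3 E3).hasFDerivAt.comp_hasDerivWithinAt t (hy t ht).2
    refine (h1.sub h2).congr_deriv ?_
    change x2Dot (virtualControl u d t (s t)) (d t) ‖virtualControl u d t (s t)‖ (s t).2.2.1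
      (s t).2.2.2 - (u ((y t).1, (y t).2, d t) - d t) = _
    have h3 : virtualControl u d t (s t) ≠ 0 := hu0 t (ha.trans ht.1) _ _
    rw [x2Dot_eq h3]
    simp only [hΔ, hp, thrust, virtualControl]
    abel
  have hE : ∀ t ∈ Icc a b, HasDerivWithinAt
      (fun t => ‖A t‖ ^ 2 + ‖B t‖ ^ 2 +
        Q * (compositeV Vξ k₂ (s t) - compositeV Vξ k₂ (s b)))
      (2 * inner ℝ (A t) (B t) + 2 * inner ℝ (B t) (Δ t + p t) +
        Q * fderiv ℝ (compositeV Vξ k₂) (s t) (closedLoop u Vξ d k₂ c κ₁ ψ t (s t)))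
      (Icc a b) t := fun t ht =>
    ((hAd t ht).norm_sq.add (hBd t ht).norm_sq).add
      (((hVc.hasDerivWithinAt (hs t ht).2 (hsD t ht)).sub_const _).const_mul Q)
  have hle : ∀ t ∈ Icc a b, 2 * inner ℝ (A t) (B t) + 2 * inner ℝ (B t) (Δ t + p t) +
      Q * fderiv ℝ (compositeV Vξ k₂) (s t) (closedLoop u Vξ d k₂ c κ₁ ψ t (s t)) ≤
      (3 + L ^ 2) * (‖A t‖ ^ 2 + ‖B t‖ ^ 2 +
        Q * (compositeV Vξ k₂ (s t) - compositeV Vξ k₂ (s b))) := fun t ht => by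
    have ht0 := ha.trans ht.1
    obtain ⟨hC1, hC2⟩ := hC t ht0 _ (hsr t ht)
    have hΔle : ‖Δ t‖ ^ 2 ≤ L ^ 2 * (‖A t‖ ^ 2 + ‖B t‖ ^ 2) := by
      calc ‖Δ t‖ ^ 2 ≤ (L * ‖((s t).1, (s t).2.1) - y t‖) ^ 2 := by
            gcongr
            exact hC2 _ (hyr t ht)
        _ = L ^ 2 * ‖((s t).1, (s t).2.1) - y t‖ ^ 2 := mul_pow _ _ _
        _ ≤ _ := by
            gcongr
            exact hsq t
    have hple : ‖p t‖ ^ 2 ≤ 4 * C ^ 2 * ((1 - (s t).2.2.1 2) / (1 + (s t).2.2.1 2)) :=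
      norm_coupling_sq_le (hsD t ht) (norm_nonneg _) hC1
    have hVd := closedLoop_deriv_le (ψ := ψ) hV.differentiable hk₂ hc hκk hu0 ht0 (hsD t ht)
    have hVξd := hV.deriv_nonpos t ht0 ((s t).1, (s t).2.1) (mem_univ _)
    have hQV : Q * fderiv ℝ (compositeV Vξ k₂) (s t) (closedLoop u Vξ d k₂ c κ₁ ψ t (s t)) ≤
        -(4 * C ^ 2 * ((1 - (s t).2.2.1 2) / (1 + (s t).2.2.1 2))) := by
      have h1 : fderiv ℝ (compositeV Vξ k₂) (s t) (closedLoop u Vξ d k₂ c κ₁ ψ t (s t)) ≤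
          -(k₁ / k₂ * ((1 - (s t).2.2.1 2) / (1 + (s t).2.2.1 2))) := by
        refine hVd.trans ?_
        linarith
      refine (mul_le_mul_of_nonneg_left h1 hQ0).trans_eq ?_
      rw [hQ]
      field_simp
    have hAB : 2 * inner ℝ (A t) (B t) ≤ ‖A t‖ ^ 2 + ‖B t‖ ^ 2 := by
      linarith [norm_sub_sq_real (A t) (B t), sq_nonneg ‖A t - B t‖]
    have hBΔ : 2 * inner ℝ (B t) (Δ t) ≤ ‖B t‖ ^ 2 + ‖Δ t‖ ^ 2 := by
      linarith [norm_sub_sq_real (B t) (Δ t), sq_nonneg ‖B t - Δ t‖]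
    have hBp : 2 * inner ℝ (B t) (p t) ≤ ‖B t‖ ^ 2 + ‖p t‖ ^ 2 := by
      linarith [norm_sub_sq_real (B t) (p t), sq_nonneg ‖B t - p t‖]
    have hpos : 0 ≤ (3 + L ^ 2) *
        (Q * (compositeV Vξ k₂ (s t) - compositeV Vξ k₂ (s b))) := by
      have := hanti ht ⟨ht.1.trans ht.2, le_rfl⟩ ht.2
      have : 0 ≤ compositeV Vξ k₂ (s t) - compositeV Vξ k₂ (s b) := sub_nonneg.2 this
      positivity
    rw [inner_add_right, mul_add (3 + L ^ 2)]
    linarith [sq_nonneg ‖A t‖]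
  intro t ht
  have hmain := le_mul_exp_of_hasDerivWithinAt_le hE hle t ht
  have hA0 : A a = 0 := by simp [hA, h0]
  have hB0 : B a = 0 := by simp [hB, h0]
  simp only [hA0, hB0, norm_zero, ne_eq, OfNat.ofNat_ne_zero, not_false_eq_true, zero_pow,
    zero_add] at hmain
  have hpos : 0 ≤ Q * (compositeV Vξ k₂ (s t) - compositeV Vξ k₂ (s b)) :=
    mul_nonneg hQ0 (sub_nonneg.2 (hanti ht ⟨ht.1.trans ht.2, le_rfl⟩ ht.2))
  linarith [hsq t]

end Comparison

/-! ### Uniform convergence -/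

section Attractivity

variable {u : E3 × E3 × E3 → E3} {Vξ : E3 × E3 → ℝ} {d : ℝ → E3} {k₁ k₂ c : ℝ}
  {κ₁ ψ : ℝ → State → ℝ}

theorem isOpen_ne_neg_zeta : IsOpen {s : State | s.2.2.1 ≠ -zeta} :=
  isOpen_ne_fun (by fun_prop : Continuous fun s : State => s.2.2.1) continuous_const

theorem setD_eq : setD = stateSpace ∩ {s : State | s.2.2.1 ≠ -zeta} := by
  ext s
  exact ⟨fun h => ⟨⟨h.1, h.2.2⟩, h.2.1⟩, fun h => ⟨h.1.1, h.2, h.1.2⟩⟩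

/-- A nonincreasing nonnegative function that starts below `c₀` decreases by less than `γ` on one
of any `N > c₀ / γ` consecutive windows of length `L`. -/
theorem exists_window_sub_lt {f : ℝ → ℝ} {t₀ L γ c₀ : ℝ} {N : ℕ} (hN : c₀ < N * γ)
    (h0 : f t₀ ≤ c₀) (hpos : 0 ≤ f (t₀ + N * L)) :
    ∃ i < N, f (t₀ + i * L) - f (t₀ + (i + 1) * L) < γ := by
  by_contra! hcon
  have key : ∀ i : ℕ, i ≤ N → f (t₀ + i * L) ≤ c₀ - i * γ := fun i => by
    induction i with
    | zero => intro _; simpa using h0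
    | succ i ih =>
      intro hi
      have h1 := ih (by omega)
      have h2 := hcon i (by omega)
      push_cast
      linarith
  linarith [key N le_rfl]

/-- On every sublevel set the composite function converges to `0` along the solutions, uniformly in
the initial time and state. On a long time interval there is a window on which it hardly decreases;
there the translational subsystem follows the double integrator into a neighbourhood of the origin,
and the attitude error has to be small at some time. -/
theorem exists_time_compositeV_lt
    (hV : IsLyapunovFunction (doubleIntegrator u d) {0} univ Vξ)
    (hgas : IsGloballyAsymptoticallyStable (doubleIntegrator u d) univ {0})
    (hu : ContDiff ℝ 1 u) (hd : Continuous d) {B : ℝ} (hB : ∀ t, 0 ≤ t → ‖d t‖ ≤ B)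
    (hk₁ : 0 < k₁) (hk₂ : 0 < k₂) (hc : 0 < c)
    (hκk : ∀ t : ℝ, 0 ≤ t → ∀ s ∈ setD, k₁ ≤ κ₁ t s)
    (hu0 : ∀ t : ℝ, 0 ≤ t → ∀ ξ₁ ξ₂ : E3, u (ξ₁, ξ₂, d t) ≠ 0)
    (c₀ : ℝ) {η : ℝ} (hη : 0 < η) :
    ∃ τ > 0, ∀ t₀ T : ℝ, 0 ≤ t₀ → t₀ + τ ≤ T → ∀ s : ℝ → State,
      IsSolution (closedLoop u Vξ d k₂ c κ₁ ψ) stateSpace (Icc t₀ T) s → s t₀ ∈ setD →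
      compositeV Vξ k₂ (s t₀) ≤ c₀ → compositeV Vξ k₂ (s T) < η := by
  have hVc := isLyapunovFunction_compositeV (ψ := ψ) hV hk₁ hk₂ hc hκk hu0
  obtain ⟨r, hr⟩ := (hV.isCompact_sublevel c₀).isBounded.subset_closedBall 0
  obtain ⟨Λ, C, hC0, hC⟩ := exists_lipschitz_bound hu hB r
  -- `‖ξ‖ < 2 ρ` makes the translational part smaller than `η / 2`
  obtain ⟨ρ, hρ, hρV⟩ : ∃ ρ > 0, ∀ ξ : E3 × E3, ‖ξ‖ < 2 * ρ → Vξ ξ < η / 2 := by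
    have h1 : ∀ᶠ ξ in 𝓝 (0 : E3 × E3), Vξ ξ < η / 2 :=
      (hV.contDiff.continuous.continuousAt (x := 0)).eventually
        (gt_mem_nhds (by rw [hV.eq_zero 0 rfl]; positivity))
    obtain ⟨δ, hδ, hδV⟩ := Metric.eventually_nhds_iff.1 h1
    exact ⟨δ / 2, by positivity, fun ξ hξ => hδV (by rw [dist_zero_right]; linarith)⟩
  obtain ⟨τ₀, hτ₀, hatt⟩ := hgas.2.2 (|r| + 1) (by positivity) ρ hρ
  set L := τ₀ + 1 with hL
  set Q := 4 * C ^ 2 * k₂ / k₁ * Real.exp ((3 + Λ ^ 2) * L) with hQ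
  have hQ0 : 0 ≤ Q := by positivity
  set γ := min (ρ ^ 2 / (Q + 1)) (η * k₁) with hγ
  have hγ0 : 0 < γ := by positivity
  obtain ⟨N, hN⟩ := exists_nat_gt (max (c₀ / γ) 0)
  have hN1 : c₀ < N * γ := (div_lt_iff₀ hγ0).1 ((le_max_left _ _).trans_lt hN)
  have hN0 : (0 : ℝ) < N := (le_max_right _ _).trans_lt hN
  have hL0 : 0 < L := by positivity
  refine ⟨N * L, by positivity, fun t₀ T ht₀ hT s hs hsD hsc => ?_⟩
  have hmem := hs.mem_and_le hVc isOpen_ne_neg_zeta setD_eq ht₀ hsD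
  have hanti := hs.antitoneOn hVc isOpen_ne_neg_zeta setD_eq ht₀ hsD
  have hNL : 0 < N * L := by positivity
  have hnonneg : ∀ t ∈ Icc t₀ T, 0 ≤ compositeV Vξ k₂ (s t) := fun t ht =>
    (hV.nonneg _).trans (le_compositeV hk₂ (hmem t ht).1)
  obtain ⟨i, hiN, hi⟩ := exists_window_sub_lt (f := fun t => compositeV Vξ k₂ (s t)) (L := L)
    hN1 hsc (hnonneg _ ⟨by linarith, hT⟩)
  set a := t₀ + i * L with ha
  have hiN' : (i : ℝ) + 1 ≤ N := by exact_mod_cast hiN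
  have hi0 : 0 ≤ (i : ℝ) * L := by positivity
  have hb : t₀ + (i + 1) * L = a + L := by rw [ha]; ring
  have hbT : a + L ≤ T := by
    have : ((i : ℝ) + 1) * L ≤ N * L := by gcongr
    linarith
  rw [hb] at hi
  have hta : t₀ ≤ a := by linarith
  have hsub : Icc a (a + L) ⊆ Icc t₀ T := Icc_subset_Icc hta hbT
  have hξ : ∀ t ∈ Icc t₀ T, ((s t).1, (s t).2.1) ∈ {ξ | ξ ∈ univ ∧ Vξ ξ ≤ c₀} := fun t ht =>
    ⟨mem_univ _, (le_compositeV hk₂ (hmem t ht).1).trans ((hmem t ht).2.trans hsc)⟩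
  have ha0 : 0 ≤ a := ht₀.trans hta
  have haI : a ∈ Icc a (a + L) := ⟨le_rfl, by linarith⟩
  obtain ⟨y, hy, hya⟩ := exists_doubleIntegrator_solution hV hu.continuous hd ha0 (a + L)
    ((s a).1, (s a).2.1)
  have hyc : ∀ t ∈ Icc a (a + L), y t ∈ {ξ | ξ ∈ univ ∧ Vξ ξ ≤ c₀} := fun t ht =>
    ⟨mem_univ _, ((hy.mem_and_le hV isOpen_univ (by simp) ha0 (mem_univ _) t ht).2).trans
      (by rw [hya]; exact (hξ a (hsub haI)).2)⟩
  have hcomp := norm_sub_sq_le_of_isSolution hV hk₁ hk₂ hc hκk hu0 hC ha0 (hs.mono hsub)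
    (fun t ht => (hmem t (hsub ht)).1) (fun t ht => hr (hξ t (hsub ht))) hy
    (fun t ht => hr (hyc t ht)) hya
  -- a time in the last unit of the window at which the attitude error is small
  have hsub' : Icc (a + τ₀) (a + L) ⊆ Icc t₀ T :=
    (Icc_subset_Icc (by linarith) le_rfl).trans hsub
  obtain ⟨t, ht, hslope⟩ := exists_hasDerivAt_eq_slope (fun t => compositeV Vξ k₂ (s t))
    (fun t => fderiv ℝ (compositeV Vξ k₂) (s t) (closedLoop u Vξ d k₂ c κ₁ ψ t (s t)))
    (by linarith : a + τ₀ < a + L)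
    (fun t ht => ((hVc.hasDerivWithinAt (hs t (hsub' ht)).2
      (hmem t (hsub' ht)).1).mono hsub').continuousWithinAt)
    (fun t ht => (hVc.hasDerivWithinAt (hs t (hsub' ⟨ht.1.le, ht.2.le⟩)).2
      (hmem t (hsub' ⟨ht.1.le, ht.2.le⟩)).1).hasDerivAt
        (Icc_mem_nhds (by linarith [ht.1]) (by linarith [ht.2])))
  have htI : t ∈ Icc a (a + L) := ⟨by linarith [ht.1], ht.2.le⟩
  have htD := (hmem t (hsub htI)).1
  have ht0 : 0 ≤ t := ha0.trans htI.1
  set drop := compositeV Vξ k₂ (s a) - compositeV Vξ k₂ (s (a + L)) with hdrop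
  have hdrop0 : 0 ≤ drop := sub_nonneg.2 (hanti (hsub haI) (hsub ⟨by linarith, le_rfl⟩)
    (by linarith))
  have hatt1 : (1 - (s t).2.2.1 2) / (1 + (s t).2.2.1 2) / (2 * k₂) < η / 2 := by
    have h1 := closedLoop_deriv_le (ψ := ψ) hV.differentiable hk₂ hc hκk hu0 ht0 htD
    have h2 := hV.deriv_nonpos t ht0 ((s t).1, (s t).2.1) (mem_univ _)
    have h3 : compositeV Vξ k₂ (s (a + τ₀)) ≤ compositeV Vξ k₂ (s a) :=
      hanti (hsub haI) (hsub ⟨by linarith, by linarith⟩) (by linarith)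
    rw [hslope, show a + L - (a + τ₀) = 1 by rw [hL]; ring, div_one] at h1
    have h4 : k₁ / k₂ * ((1 - (s t).2.2.1 2) / (1 + (s t).2.2.1 2)) < η * k₁ := by
      have := hi.trans_le (min_le_right _ _)
      linarith
    have h5 : k₁ / k₂ * ((1 - (s t).2.2.1 2) / (1 + (s t).2.2.1 2)) =
        (1 - (s t).2.2.1 2) / (1 + (s t).2.2.1 2) / (2 * k₂) * (2 * k₁) := by
      field_simp
    rw [h5] at h4
    nlinarith
  have hξt : ‖((s t).1, (s t).2.1)‖ < 2 * ρ := by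
    have hyt : ‖y t‖ < ρ := by
      have h1 := hatt a t ha0 ht.1.le y (hy.mono (Icc_subset_Icc le_rfl htI.2)) (by
        rw [Metric.infDist_singleton]
        have := Metric.mem_closedBall.1 (hr (hyc a haI))
        linarith [le_abs_self r])
      rwa [Metric.infDist_singleton, dist_zero_right] at h1
    have hdist : ‖((s t).1, (s t).2.1) - y t‖ < ρ := by
      refine lt_of_pow_lt_pow_left₀ 2 hρ.le ((hcomp t htI).trans_lt ?_)
      calc 4 * C ^ 2 * k₂ / k₁ * drop * Real.exp ((3 + Λ ^ 2) * (t - a))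
          ≤ 4 * C ^ 2 * k₂ / k₁ * drop * Real.exp ((3 + Λ ^ 2) * L) := by
            gcongr
            linarith [htI.2]
        _ = Q * drop := by rw [hQ]; ring
        _ ≤ Q * (ρ ^ 2 / (Q + 1)) := by
            gcongr
            exact (hi.trans_le (min_le_left _ _)).le
        _ < ρ ^ 2 := by
            rw [mul_div_assoc', div_lt_iff₀ (by positivity)]
            nlinarith [pow_pos hρ 2]
    calc ‖((s t).1, (s t).2.1)‖ = ‖(((s t).1, (s t).2.1) - y t) + y t‖ := by rw [sub_add_cancel]
      _ ≤ ‖((s t).1, (s t).2.1) - y t‖ + ‖y t‖ := norm_add_le _ _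
      _ < 2 * ρ := by linarith
  have hfin : compositeV Vξ k₂ (s t) < η := by
    rw [compositeV_eq]
    linarith [hρV _ hξt]
  exact (hanti (hsub htI) ⟨(hsub htI).1.trans (hsub htI).2, le_rfl⟩ (hsub htI).2).trans_lt hfin

end Attractivity

/-! ### Stability and region of attraction -/

section RegionOfAttraction

variable {X : Type*} [NormedAddCommGroup X] [NormedSpace ℝ X]
variable {F : ℝ → X → X} {M A D O : Set X} {V : X → ℝ}

/-- If the sublevel sets of `V` are neighbourhoods of `A` in the state space, then `A` is uniformly
stable. -/
theorem IsLyapunovFunction.isUniformlyStable (hV : IsLyapunovFunction F A D V) (hO : IsOpen O)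
    (hDO : D = M ∩ O)
    (hnear : ∀ c > 0, ∃ δ > 0, ∀ x ∈ M, Metric.infDist x A < δ → x ∈ D ∧ V x < c) :
    IsUniformlyStable F M A := by
  intro ε hε
  obtain ⟨c, hc, hcε⟩ := hV.exists_infDist_lt hε
  obtain ⟨δ, hδ, hδc⟩ := hnear c hc
  refine ⟨δ, hδ, fun t₀ T ht₀ hT s hs h0 => ?_⟩
  obtain ⟨hD, hlt⟩ := hδc _ (hs t₀ ⟨le_rfl, hT⟩).1 h0
  obtain ⟨hD', hle⟩ := hs.mem_and_le hV hO hDO ht₀ hD T ⟨hT, le_rfl⟩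
  exact hcε _ hD' (hle.trans_lt hlt)

/-- The domain `D` of a Lyapunov function is in the region of attraction of `A` if the Lyapunov
function converges to `0` along solutions, uniformly on its sublevel sets. The tangent extensions
provide the existence of solutions. -/
theorem IsLyapunovFunction.subset_regionOfAttraction [FiniteDimensional ℝ X]
    (hV : IsLyapunovFunction F A D V) (hO : IsOpen O) (hDO : D = M ∩ O)
    (hF : ContinuousOn (fun q : ℝ × X => F q.1 q.2) (Ici 0 ×ˢ D))
    (hext : ∀ a b c : ℝ, 0 ≤ a → HasTangentExtension F M {x | x ∈ D ∧ V x ≤ c} a b)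
    (hconv : ∀ c η : ℝ, 0 < η → ∃ τ > 0, ∀ t₀ T : ℝ, 0 ≤ t₀ → t₀ + τ ≤ T → ∀ s : ℝ → X,
      IsSolution F M (Icc t₀ T) s → s t₀ ∈ D → V (s t₀) ≤ c → V (s T) < η) :
    D ⊆ regionOfAttraction F M A := by
  have : ProperSpace X := FiniteDimensional.proper ℝ X
  have hglobal : ∀ t₀ : ℝ, 0 ≤ t₀ → ∀ x ∈ D, ∃ s, IsSolution F M (Ici t₀) s ∧ s t₀ = x := by
    intro t₀ ht₀ x hx
    refine exists_isSolution_Ici (D := D) (fun a ha z hz => ?_) hx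
    have ha0 : 0 ≤ a := ht₀.trans ha
    obtain ⟨s, hs, hsa⟩ := exists_isSolution_Icc hV hO hDO ha0 hz (hext a (a + 1) _ ha0)
    exact ⟨s, hs, hsa, (hs.mem_and_le hV hO hDO ha0 (by rwa [hsa]) (a + 1)
      ⟨by linarith, le_rfl⟩).1⟩
  intro x hx
  refine ⟨by rw [hDO] at hx; exact hx.1, fun t₀ ht₀ => ⟨hglobal t₀ ht₀ x hx, ?_, ?_⟩⟩
  · intro T hT s hs hst
    obtain ⟨s₁, hs₁, heq, hTD⟩ := hs.exists_extend_Icc hV hO hDO hF ht₀ hT (by rwa [hst])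
    obtain ⟨s₂, hs₂, hs₂T⟩ := hglobal T (ht₀.trans hT.le) _ hTD
    have h := hs₁.concat hs₂ isClosed_Icc isClosed_Ici (fun t ht => ht.2) (fun t ht => ht) hs₂T.symm
    rw [Icc_union_Ici_eq_Ici hT.le] at h
    exact ⟨_, h, fun t ht => (heq ht).trans (if_pos ht.2.le).symm⟩
  · intro s hs hst
    rw [Metric.tendsto_atTop]
    intro ε hε
    obtain ⟨η, hη, hηε⟩ := hV.exists_infDist_lt hε
    obtain ⟨τ, hτ, hconv'⟩ := hconv (V x) η hη
    refine ⟨t₀ + τ, fun T hT => ?_⟩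
    have hsT : IsSolution F M (Icc t₀ T) s := hs.mono fun t ht => ht.1
    have h0 : s t₀ ∈ D := by rwa [hst]
    have h1 := hconv' t₀ T ht₀ hT s hsT h0 (by rw [hst])
    have h2 := (hsT.mem_and_le hV hO hDO ht₀ h0 T ⟨by linarith, le_rfl⟩).1
    rw [Real.dist_eq, sub_zero, abs_of_nonneg Metric.infDist_nonneg]
    exact hηε _ h2 h1

variable {Vξ : E3 × E3 → ℝ} {k₂ : ℝ}

/-- The sublevel sets of the composite function are neighbourhoods of `𝒜`: the function does not
depend on `R`, and it is continuous at `x = (0, 0, ζ)`. -/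
theorem exists_compositeV_lt_of_infDist_lt (hV : ContDiff ℝ 1 Vξ) (h0 : Vξ 0 = 0) (hk₂ : k₂ ≠ 0)
    {c : ℝ} (hc : 0 < c) :
    ∃ δ > 0, ∀ s ∈ stateSpace, Metric.infDist s setA < δ →
      s ∈ setD ∧ compositeV Vξ k₂ s < c := by
  have h1 : (1 : Mat3) ∈ SO3 := by simp [mem_SO3_iff]
  set s₀ : State := (0, 0, zeta, 1) with hs₀
  have hs₀D : s₀ ∈ setD := by
    refine ⟨norm_zeta, fun h => ?_, h1⟩
    have := congrArg (fun v : E3 => v 2) h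
    simp [hs₀] at this
    linarith
  have hV0 : compositeV Vξ k₂ s₀ = 0 := by
    rw [compositeV_eq]
    have h0' : Vξ (0, 0) = 0 := h0
    simp [hs₀, h0']
  have hA : setA.Nonempty := ⟨s₀, rfl, rfl, rfl, h1⟩
  have hev : ∀ᶠ s in 𝓝 s₀, compositeV Vξ k₂ s < c ∧ s.2.2.1 ≠ -zeta :=
    ((contDiffAt_compositeV hV hk₂ hs₀D).continuousAt.eventually
      (gt_mem_nhds (by rwa [hV0]))).and (isOpen_ne_neg_zeta.mem_nhds hs₀D.2.1)
  obtain ⟨δ, hδ, hball⟩ := Metric.eventually_nhds_iff.1 hev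
  refine ⟨δ, hδ, fun s hs hlt => ?_⟩
  obtain ⟨x, hx, hdist⟩ := (Metric.infDist_lt_iff hA).1 hlt
  obtain ⟨hx1, hx2, hx3, -⟩ := hx
  have hclose : dist ((s.1, s.2.1, s.2.2.1, 1) : State) s₀ < δ := by
    simp only [Prod.dist_eq, max_lt_iff, hx1, hx2, hx3] at hdist
    simp only [hs₀, Prod.dist_eq, max_lt_iff, dist_self]
    exact ⟨hdist.1, hdist.2.1, hdist.2.2.1, hδ⟩
  have h := hball hclose
  exact ⟨⟨hs.1, h.2, hs.2⟩, h.1⟩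

theorem contDiff_dSignal {pr : ℝ → E3} (hpr : ContDiff ℝ ∞ pr) (g : ℝ) :
    ContDiff ℝ 1 (dSignal pr g) := by
  have h1 : ContDiff ℝ ∞ (deriv pr) := (contDiff_infty_iff_deriv.1 hpr).2
  have h2 : ContDiff ℝ ∞ (deriv (deriv pr)) := (contDiff_infty_iff_deriv.1 h1).2
  have h3 : dSignal pr g = fun t => deriv (deriv pr) t + g • zeta := by
    funext t
    rw [dSignal, iteratedDeriv_succ, iteratedDeriv_one]
  rw [h3]
  exact (h2.of_le (by exact_mod_cast le_top)).add contDiff_const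

end RegionOfAttraction
end Quadrotor

theorem theorem1
    -- the reference trajectory, with bounded acceleration
    (pr : ℝ → E3) (hpr : ContDiff ℝ ∞ pr)
    (hacc : ∃ B : ℝ, ∀ t : ℝ, 0 ≤ t → ‖iteratedDeriv 2 pr t‖ ≤ B)
    (g : ℝ)
    -- the stabilizer of the double integrator and its Lyapunov function
    (u : E3 × E3 × E3 → E3) (hu : ContDiff ℝ 1 u)
    (hε : ∃ ε > 0, ∀ t : ℝ, 0 ≤ t → ∀ ξ₁ ξ₂ : E3, ε ≤ ‖u (ξ₁, ξ₂, dSignal pr g t)‖)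
    (hgas : IsGloballyAsymptoticallyStable (doubleIntegrator u (dSignal pr g)) univ {0})
    (Vξ : E3 × E3 → ℝ)
    (hV : IsLyapunovFunction (doubleIntegrator u (dSignal pr g)) {0} univ Vξ)
    -- the parameters of the attitude law and the free yaw rate
    (k₁ k₂ c : ℝ) (hk₁ : 0 < k₁) (hk₂ : 0 < k₂) (hc : 0 < c)
    (κ₁ : ℝ → State → ℝ)
    (hκ : ContinuousOn (fun q : ℝ × State => κ₁ q.1 q.2) (Ici 0 ×ˢ setD))
    (hκk : ∀ t : ℝ, 0 ≤ t → ∀ s ∈ setD, k₁ ≤ κ₁ t s)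
    (ψ : ℝ → State → ℝ)
    (hψ : ContinuousOn (fun q : ℝ × State => ψ q.1 q.2) (Ici 0 ×ˢ setD)) :
    IsAsymptoticallyStable (closedLoop u Vξ (dSignal pr g) k₂ c κ₁ ψ) stateSpace setA ∧
    setD ⊆ regionOfAttraction (closedLoop u Vξ (dSignal pr g) k₂ c κ₁ ψ) stateSpace setA ∧
    IsLyapunovFunction (closedLoop u Vξ (dSignal pr g) k₂ c κ₁ ψ) setA setD
      (compositeV Vξ k₂) ∧
    (IsStrictLyapunovFunction (doubleIntegrator u (dSignal pr g)) {0} univ Vξ →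
      IsStrictLyapunovFunction (closedLoop u Vξ (dSignal pr g) k₂ c κ₁ ψ) setA setD
        (compositeV Vξ k₂)) ∧
    (∀ t₀ T : ℝ, 0 ≤ t₀ → t₀ ≤ T → ∀ s : ℝ → State,
      IsSolution (closedLoop u Vξ (dSignal pr g) k₂ c κ₁ ψ) stateSpace (Icc t₀ T) s →
      s t₀ ∈ thrustConstraint u (dSignal pr g) t₀ →
      s T ∈ thrustConstraint u (dSignal pr g) T) := by
  have hd := contDiff_dSignal hpr g
  obtain ⟨B, hB⟩ := hacc
  have hdB : ∀ t, 0 ≤ t → ‖dSignal pr g t‖ ≤ B + ‖g • zeta‖ := fun t ht =>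
    (norm_add_le _ _).trans (by linarith [hB t ht])
  have hu0 : ∀ t : ℝ, 0 ≤ t → ∀ ξ₁ ξ₂ : E3, u (ξ₁, ξ₂, dSignal pr g t) ≠ 0 := by
    obtain ⟨ε, hε0, hε'⟩ := hε
    exact fun t ht ξ₁ ξ₂ => norm_pos_iff.1 (hε0.trans_le (hε' t ht ξ₁ ξ₂))
  have hVc := isLyapunovFunction_compositeV (ψ := ψ) hV hk₁ hk₂ hc hκk hu0
  have hconv := fun (c₀ η : ℝ) (hη : 0 < η) => exists_time_compositeV_lt (ψ := ψ) hV hgas hu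
    hd.continuous hdB hk₁ hk₂ hc hκk hu0 c₀ hη
  have hnear := fun (r : ℝ) (hr : 0 < r) => exists_compositeV_lt_of_infDist_lt (k₂ := k₂)
    hV.contDiff (hV.eq_zero 0 rfl) hk₂.ne' hr
  refine ⟨⟨hVc.isUniformlyStable isOpen_ne_neg_zeta setD_eq hnear, ?_⟩, ?_, hVc, ?_, ?_⟩
  · obtain ⟨r, hr, hr1⟩ := hnear 1 one_pos
    refine ⟨r, hr, fun η hη => ?_⟩
    obtain ⟨c₁, hc₁, hc₁η⟩ := hVc.exists_infDist_lt hη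
    obtain ⟨τ, hτ, hτ'⟩ := hconv 1 c₁ hc₁
    refine ⟨τ, hτ, fun t₀ T ht₀ hT s hs h0 => ?_⟩
    have htT : t₀ ≤ T := by linarith
    obtain ⟨hD, hlt⟩ := hr1 _ (hs t₀ ⟨le_rfl, htT⟩).1 h0
    exact hc₁η _ (hs.mem_and_le hVc isOpen_ne_neg_zeta setD_eq ht₀ hD T ⟨htT, le_rfl⟩).1
      (hτ' t₀ T ht₀ hT s hs hD hlt.le)
  · exact hVc.subset_regionOfAttraction isOpen_ne_neg_zeta setD_eq
      (continuousOn_closedLoop hu hV.contDiff hd hc hu0 hκ hψ)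
      (fun a b r ha => hasTangentExtension_closedLoop hu hV.contDiff hd hc hu0 hκ hψ ha b
        (hVc.isCompact_sublevel r) fun s hs => hs.1) hconv
  · exact fun hs => isStrictLyapunovFunction_compositeV hs hk₁ hk₂ hc hκk hu0
  · exact fun t₀ T ht₀ hT s hs h0 => thrustConstraint_of_isSolution hu hd hu0 ht₀ hT hs h0
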